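/- Theorem 1 (Conditional Joint Law of the LAR Knots). Let $Y\sim\mathcal N_n(X\beta^0,\sigma^2\mathrm{Id}_n)$ with $\sigma>0$ and $X\in\mathbb R^{n\times p}$ of rank $r$, and let $1\le K<\min(n-3,r)$. Encode a variable $j\in[p]$ with sign $s=\pm1$ as the signed variable $i=j+p(1-s)/2\in[2p]$, and put $\mu^0=(X^\top X\beta^0,-X^\top X\beta^0)\in\mathbb R^{2p}$ and $R=\begin{pmatrix}X^\top X&-X^\top X\\-X^\top X&X^\top X\end{pmatrix}$. Let $\lambda_1,\dots,\lambda_{K+1}$ be the first knots and $\hat\imath_1,\dots,\hat\imath_{K+1}$ the first signed variables that enter along the Least Angle Regression (LAR) path of $(X,Y)$, ties being broken by an arbitrary fixed rule. For $i=(i_1,\dots,i_{k})$ write $M_i=(R_{i_a,i_b})_{a,b}$, $\theta_j(i)=(R_{j,i_1}\cdots R_{j,i_k})M_i^{-1}(1,\dots,1)^\top$ (and $\theta_j=0$ if $k=0$), and define, with $\hat\imath^{\,k-1}=(\hat\imath_1,\dots,\hat\imath_{k-1})$, $$m_k=\frac{\mu^0_{\hat\imath_k}-(R_{\hat\imath_k,\hat\imath_1}\cdots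 R_{\hat\imath_k,\hat\imath_{k-1}})M_{\hat\imath^{\,k-1}}^{-1}(\mu^0_{\hat\imath_1},\dots,\mu^0_{\hat\imath_{k-1}})^\top}{1-\theta_{\hat\imath_k}(\hat\imath^{\,k-1})},$$ $$\rho_k=\frac{\sqrt{R_{\hat\imath_k,\hat\imath_k}-(R_{\hat\imath_k,\hat\imath_1}\cdots R_{\hat\imath_k,\hat\imath_{k-1}})M_{\hat\imath^{\,k-1}}^{-1}(R_{\hat\imath_k,\hat\imath_1},\dots,R_{\hat\imath_k,\hat\imath_{k-1}})^\top}}{1-\theta_{\hat\imath_k}(\hat\imath^{\,k-1})}.$$ A sequence of signed variables with variables $j_1,\dots,j_K$ and signs $s_1,\dots,s_K$ satisfies the Irrepresentable Check if for all $1\le k\le K$ and all $j\in[p]\setminus T$, where $T=\{j_1,\dots,j_k\}$, one has $|X_j^\top X_{T}(X_{T}^\top X_{T})^{-1}(s_1,\dots,s_k)^\top|<1$. Then, almost surely, if $(\hat\imath_1,\dots,\hat\imath_K)$ satisfies the Irrepresentable Check, the conditional law of $(\lambda_1,\dots,\lambda_K)$ given $(\hat\imath_1,\dots,\hat\imath_K,\lambda_{K+1})$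 has density, with respect to Lebesgue measure on $\mathbb R^K$, $$Q^{-1}\Big(\prod_{k=1}^K\varphi_{m_k,\sigma^2\rho_k^2}(\ell_k)\Big)\mathbf 1_{\{\ell_1\ge\ell_2\ge\dots\ge\ell_K\ge\lambda_{K+1}\}},$$ where $\varphi_{m,v}$ is the Gaussian density with mean $m$ and variance $v$ and $0<Q<\infty$ is the normalizing constant, which depends on $(\hat\imath_1,\dots,\hat\imath_K,\lambda_{K+1})$. In other words, this conditional law is the law of independent Gaussian variables with means $m_k$ and variances $\sigma^2\rho_k^2$, conditioned on the event that they are ordered, $\ell_1\ge\dots\ge\ell_K\ge\lambda_{K+1}$. -/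

import Mathlib

open MeasureTheory ProbabilityTheory
open scoped Matrix NNReal ENNReal

noncomputable section

namespace LAR

variable {n p : ℕ}

/-- Signed variables, i.e. the index set `[2p] = [p] ⊔ [p]`: `Sum.inl j` encodes the variable `j`
with sign `+1` and `Sum.inr j` encodes the variable `j` with sign `-1`. -/
abbrev SignedVar (p : ℕ) : Type := Fin p ⊕ Fin p

/-- The unsigned variable of a signed variable. -/
def var : SignedVar p → Fin p := Sum.elim id id

/-- The sign `±1` of a signed variable. -/
def sgn : SignedVar p → ℝ := Sum.elim (fun _ => 1) (fun _ => -1)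

/-- The vector `(u, -u)` indexed by the signed variables. -/
def signed (u : Fin p → ℝ) : SignedVar p → ℝ := Sum.elim u (-u)

/-- `Z = (Xᵀ y, -Xᵀ y)`. -/
def signedCorr (X : Matrix (Fin n) (Fin p) ℝ) (y : EuclideanSpace ℝ (Fin n)) : SignedVar p → ℝ :=
  signed (Xᵀ *ᵥ y.ofLp)

/-- `μ⁰ = (Xᵀ X β, -Xᵀ X β)`, the mean of `Z`. -/
def signedMean (X : Matrix (Fin n) (Fin p) ℝ) (β : Fin p → ℝ) : SignedVar p → ℝ :=
  signed ((Xᵀ * X) *ᵥ β)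

/-- `R`, so that `σ² R` is the variance-covariance matrix of `Z`. -/
def signedGram (X : Matrix (Fin n) (Fin p) ℝ) : Matrix (SignedVar p) (SignedVar p) ℝ :=
  Matrix.fromBlocks (Xᵀ * X) (-(Xᵀ * X)) (-(Xᵀ * X)) (Xᵀ * X)

/-- `(R_{j,i₁} ⋯ R_{j,i_k}) M⁻¹ (z_{i₁}, …, z_{i_k})` with `M = (R_{i_a,i_b})_{a,b}`. -/
def regress (X : Matrix (Fin n) (Fin p) ℝ) {k : ℕ} (i : Fin k → SignedVar p)
    (z : Fin k → ℝ) (j : SignedVar p) : ℝ :=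
  (fun a => signedGram X j (i a)) ⬝ᵥ (((signedGram X).submatrix i i)⁻¹ *ᵥ z)

/-- `θ_j(i₁, …, i_k)`. -/
def theta (X : Matrix (Fin n) (Fin p) ℝ) {k : ℕ} (i : Fin k → SignedVar p) (j : SignedVar p) : ℝ :=
  regress X i (fun _ => 1) j

/-! ### The LAR algorithm -/

/-- The state of the LAR algorithm after `m` variables have entered: these `m` signed variables
in order of entrance, the `m`-th knot, and the residual correlations `N = (N̄, -N̄)` at that knot. -/
structure State (p m : ℕ) where
  /-- the signed variables that have entered -/
  vars : Fin m → SignedVar p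
  /-- the current knot -/
  knot : ℝ
  /-- the residual correlations at the current knot -/
  resid : SignedVar p → ℝ

/-- The set of maximizers of `f` on `s`. -/
def argmaxOn (s : Finset (SignedVar p)) (f : SignedVar p → ℝ) : Finset (SignedVar p) :=
  by classical exact s.filter (fun j => ∀ j' ∈ s, f j' ≤ f j)

/-- The signed variables whose unsigned variable does not appear in `i`. -/
def inactive {m : ℕ} (i : Fin m → SignedVar p) : Finset (SignedVar p) :=
  by classical exact Finset.univ.filter (fun j => ∀ a, var j ≠ var (i a))

/-- First step: `λ₁ = max Z = max |Z̄|`, `î₁ = argmax Z`, and the residual is `Z`.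
Ties are broken by `tie`. -/
def init (tie : Finset (SignedVar p) → SignedVar p) (X : Matrix (Fin n) (Fin p) ℝ)
    (y : EuclideanSpace ℝ (Fin n)) : State p 1 where
  vars := fun _ => tie (argmaxOn Finset.univ (signedCorr X y))
  knot := ⨆ j, signedCorr X y j
  resid := signedCorr X y

/-- The residual correlations `N_j(l) = N_j - (λ - l) θ_j(î₁, …, î_m)` at level `l`, when `λ` is
the last knot found and `N` the residual there. -/
def residAt (X : Matrix (Fin n) (Fin p) ℝ) {m : ℕ} (S : State p m) (l : ℝ) (j : SignedVar p) : ℝ :=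
  S.resid j - (S.knot - l) * theta X S.vars j

/-- The next knot: the largest `0 < l ≤ λ` such that `|N̄_j(l)| = l` for some variable `j` that has
not entered, i.e. such that `N_j(l) = l` for some signed variable `j` that has not entered. -/
def nextKnot (X : Matrix (Fin n) (Fin p) ℝ) {m : ℕ} (S : State p m) : ℝ :=
  sSup {l : ℝ | 0 < l ∧ l ≤ S.knot ∧ ∃ j ∈ inactive S.vars, residAt X S l j = l}

/-- One LAR step: the variable that enters is the inactive one with the largest residual
correlation `|N̄_j|` at the next knot, and its sign is that of `N̄_j`. -/
def step (tie : Finset (SignedVar p) → SignedVar p) (X : Matrix (Fin n) (Fin p) ℝ) {m : ℕ}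
    (S : State p m) : State p (m + 1) where
  vars := Fin.snoc S.vars (tie (argmaxOn (inactive S.vars) (residAt X S (nextKnot X S))))
  knot := nextKnot X S
  resid := residAt X S (nextKnot X S)

/-- The state of LAR when the first `k + 1` variables have entered. -/
def state (tie : Finset (SignedVar p) → SignedVar p) (X : Matrix (Fin n) (Fin p) ℝ)
    (y : EuclideanSpace ℝ (Fin n)) : (k : ℕ) → State p (k + 1)
  | 0 => init tie X y
  | k + 1 => step tie X (state tie X y k)

/-- The LAR knots, indexed from `0`: `knot tie X y k` is `λ_{k+1}`. -/
def knot (tie : Finset (SignedVar p) → SignedVar p) (X : Matrix (Fin n) (Fin p) ℝ)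
    (y : EuclideanSpace ℝ (Fin n)) (k : ℕ) : ℝ :=
  (state tie X y k).knot

/-- The first `K` knots `(λ₁, …, λ_K)`. -/
def knots (tie : Finset (SignedVar p) → SignedVar p) (X : Matrix (Fin n) (Fin p) ℝ) (K : ℕ)
    (y : EuclideanSpace ℝ (Fin n)) : Fin K → ℝ :=
  fun k => knot tie X y k

/-- The first `K` signed variables `(î₁, …, î_K)` that enter the LAR path. -/
def vars (tie : Finset (SignedVar p) → SignedVar p) (X : Matrix (Fin n) (Fin p) ℝ) (K : ℕ)
    (y : EuclideanSpace ℝ (Fin n)) : Fin K → SignedVar p :=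
  fun k => (state tie X y k).vars (Fin.last k)

/-! ### The Irrepresentable Check and the parameters of the law -/

/-- The Irrepresentable Check for a sequence of signed variables `i₁, …, i_K` with variables
`j₁, …, j_K` and signs `s₁, …, s_K`: for all `1 ≤ k ≤ K`, all `j ∉ T = {j₁, …, j_k}` (with either
sign), `|X_jᵀ X_T (X_Tᵀ X_T)⁻¹ (s₁, …, s_k)| < 1`. -/
def IrrCheck (X : Matrix (Fin n) (Fin p) ℝ) {K : ℕ} (i : Fin K → SignedVar p) : Prop :=
  ∀ (k : ℕ) (_ : 1 ≤ k) (hk : k ≤ K) (j : Fin p),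
    (∀ a : Fin k, j ≠ var (i (Fin.castLE hk a))) →
      let XT : Matrix (Fin n) (Fin k) ℝ := X.submatrix id (fun a => var (i (Fin.castLE hk a)))
      let s : Fin k → ℝ := fun a => sgn (i (Fin.castLE hk a))
      |X.col j ⬝ᵥ (XT *ᵥ ((XTᵀ * XT)⁻¹ *ᵥ s))| < 1

/-- The sequence `(i₁, …, i_{k-1})` that precedes the entry `i_k` (here `k : Fin K` is counted
from `0`). -/
def before {K : ℕ} (i : Fin K → SignedVar p) (k : Fin K) : Fin (k : ℕ) → SignedVar p :=
  fun a => i (Fin.castLE k.isLt.le a)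

/-- `m_k`. -/
def knotMean (X : Matrix (Fin n) (Fin p) ℝ) (β : Fin p → ℝ) {K : ℕ} (i : Fin K → SignedVar p)
    (k : Fin K) : ℝ :=
  (signedMean X β (i k)
      - regress X (before i k) (fun a => signedMean X β (before i k a)) (i k))
    / (1 - theta X (before i k) (i k))

/-- `ρ_k`. -/
def knotRho (X : Matrix (Fin n) (Fin p) ℝ) {K : ℕ} (i : Fin K → SignedVar p) (k : Fin K) : ℝ :=
  √(signedGram X (i k) (i k)
      - regress X (before i k) (fun a => signedGram X (i k) (before i k a)) (i k))
    / (1 - theta X (before i k) (i k))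

/-- `v_k² = σ² ρ_k²`. -/
def knotVar (X : Matrix (Fin n) (Fin p) ℝ) (σ : ℝ) {K : ℕ} (i : Fin K → SignedVar p)
    (k : Fin K) : ℝ≥0 :=
  ⟨σ ^ 2 * knotRho X i k ^ 2, by positivity⟩

/-- `{(ℓ₁, …, ℓ_K) : ℓ₁ ≥ ⋯ ≥ ℓ_K ≥ l}`. -/
def orderedAbove (K : ℕ) (l : ℝ) : Set (Fin K → ℝ) :=
  {x | Antitone x ∧ ∀ k, l ≤ x k}

/-- `(∏_k φ_{m_k, v_k²}(ℓ_k)) 1{ℓ₁ ≥ ⋯ ≥ ℓ_K ≥ l}`. -/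
def weight (X : Matrix (Fin n) (Fin p) ℝ) (β : Fin p → ℝ) (σ : ℝ) {K : ℕ}
    (i : Fin K → SignedVar p) (l : ℝ) : (Fin K → ℝ) → ℝ :=
  (orderedAbove K l).indicator
    (fun x => ∏ k, gaussianPDFReal (knotMean X β i k) (knotVar X σ i k) (x k))

/-- The normalizing constant `Q`. -/
def normConst (X : Matrix (Fin n) (Fin p) ℝ) (β : Fin p → ℝ) (σ : ℝ) {K : ℕ}
    (i : Fin K → SignedVar p) (l : ℝ) : ℝ :=
  ∫ x, weight X β σ i l x

end LAR

end

/-!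
Write `x_j` for the signed columns of `X`, so that `Z_j = ⟪x_j, Y⟫`. After the variables
`i₁, …, i_k` have entered, the residual correlation of `j` at level `l` is
`N_j(l) = ⟪x_j - proj x_j, Y⟫ + l θ_j`, so `N_j(l) = l` exactly at `l = ⟪knotVec i j, Y⟫`, where
`knotVec i j = (x_j - proj x_j) / (1 - θ_j)`. The Irrepresentable Check says `θ_j < 1` for every
inactive `j`, hence `N_j(l) - l` is strictly decreasing in `l`: along the path each inactive
variable crosses the level once, below the current knot, and the next knot is the largest of these
levels (`PathSpec.isGreatest_knot_succ`).

Fix a sequence `i` that satisfies the check and has independent columns, let `v_k` be the knot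
vector of `i_k` after `i₁, …, i_{k-1}`, and let `h` be the maximum of the levels of the variables
outside `i`. If the path selects `i`, its knots are `⟪v₁, Y⟫ ≥ ⋯ ≥ ⟪v_K, Y⟫` and the next one is
`h` (`knot_eq_of_pre_path_eq`, `knot_eq_nextLevel`, `knots_mem_orderedAbove`). Conversely, if
`⟪v₁, Y⟫ > ⋯ > ⟪v_K, Y⟫ > h > 0`, the path selects `i`: running the levels upwards from `h`,
no inactive variable can overtake its level, since the residual correlations are continuous at the
knots (`corrAt_succ`) and `N_j(l) - l` decreases in `l` on each piece
(`inner_knotVec_lt_of_ordered`). So up to a null set the selection event is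
`{⟪v₁, Y⟫ ≥ ⋯ ≥ ⟪v_K, Y⟫ ≥ h}`.

By construction `v₁, …, v_K` are pairwise orthogonal and orthogonal to the vectors that define `h`,
so the `⟪v_k, Y⟫` are independent Gaussian variables with means `m_k` and variances `σ² ρ_k²`, and
they are independent of `h`. Given the selection event and `h`, their law is therefore the product
of Gaussian laws conditioned on the ordered region (`condDistrib_eq_cond_of_selection`), whose
density is the one claimed (`normConst_pos_and_cond_eq`). The rank assumption makes the path run
for `K + 1` steps almost surely (`ae_unfitted`). Ties of positive probability for the entry of
`i_k`, such as those caused by equal columns, would force `θ_j = 1` for some `j` inactive after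
`i_k`, and the check excludes this; for the same reason the path can only select independent
columns.
-/

noncomputable section

namespace LAR

variable {n p : ℕ}

open scoped InnerProductSpace

/-! ### Signed columns and residual vectors -/

/-- The signed column `s_j X_{|j|}` of the design matrix, so that `R` is the Gram matrix of these
vectors and `Z_j` is the inner product of `y` with the `j`-th one. -/
def signedCol (X : Matrix (Fin n) (Fin p) ℝ) (j : SignedVar p) : EuclideanSpace ℝ (Fin n) :=
  WithLp.toLp 2 (sgn j • X.col (var j))

lemma inner_signedCol (X : Matrix (Fin n) (Fin p) ℝ) (j : SignedVar p)
    (y : EuclideanSpace ℝ (Fin n)) : ⟪signedCol X j, y⟫_ℝ = signedCorr X y j := by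
  cases j <;>
    simp [signedCol, signedCorr, signed, sgn, var, PiLp.inner_apply, Matrix.mulVec, dotProduct,
      mul_comm]

lemma signedGram_eq_inner (X : Matrix (Fin n) (Fin p) ℝ) (i j : SignedVar p) :
    signedGram X i j = ⟪signedCol X i, signedCol X j⟫_ℝ := by
  cases i <;> cases j <;>
    simp [signedCol, signedGram, sgn, var, PiLp.inner_apply, Matrix.mul_apply, mul_comm]

lemma signedMean_eq_signedCorr (X : Matrix (Fin n) (Fin p) ℝ) (β : Fin p → ℝ) :
    signedMean X β = signedCorr X (WithLp.toLp 2 (X *ᵥ β)) := by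
  simp [signedMean, signedCorr, Matrix.mulVec_mulVec]

lemma signedCol_swap (X : Matrix (Fin n) (Fin p) ℝ) (j : SignedVar p) :
    signedCol X j.swap = -signedCol X j := by
  cases j <;> ext <;> simp [signedCol, sgn, var]

lemma var_swap (j : SignedVar p) : var j.swap = var j := by cases j <;> rfl

lemma eq_or_eq_swap_of_var_eq {i j : SignedVar p} (h : var i = var j) : i = j ∨ i = j.swap := by
  cases i <;> cases j <;> simp_all [var]

lemma mem_inactive {m : ℕ} {i : Fin m → SignedVar p} {j : SignedVar p} :
    j ∈ inactive i ↔ ∀ a, var j ≠ var (i a) := by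
  simp [inactive]

lemma swap_mem_inactive {m : ℕ} {i : Fin m → SignedVar p} {j : SignedVar p}
    (h : j ∈ inactive i) : j.swap ∈ inactive i := by
  simpa [mem_inactive, var_swap] using h

lemma mem_argmaxOn {s : Finset (SignedVar p)} {f : SignedVar p → ℝ} {j : SignedVar p} :
    j ∈ argmaxOn s f ↔ j ∈ s ∧ ∀ j' ∈ s, f j' ≤ f j := by
  simp [argmaxOn]

lemma signedGram_comm (X : Matrix (Fin n) (Fin p) ℝ) (i j : SignedVar p) :
    signedGram X i j = signedGram X j i := by
  rw [signedGram_eq_inner, signedGram_eq_inner, real_inner_comm]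

/-- The signed variables `i₁, …, i_m` have linearly independent columns. -/
def Indep (X : Matrix (Fin n) (Fin p) ℝ) {m : ℕ} (i : Fin m → SignedVar p) : Prop :=
  LinearIndependent ℝ (fun a => signedCol X (i a))

lemma Indep.isUnit_det {X : Matrix (Fin n) (Fin p) ℝ} {m : ℕ} {i : Fin m → SignedVar p}
    (h : Indep X i) : IsUnit ((signedGram X).submatrix i i).det := by
  have : (signedGram X).submatrix i i = Matrix.gram ℝ (fun a => signedCol X (i a)) := by
    ext a b
    simp [signedGram_eq_inner, Matrix.gram_apply]
  rw [this, isUnit_iff_ne_zero]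
  exact Matrix.det_gram_ne_zero_iff_linearIndependent.2 h

/-- `regress` can be computed from any solution of the normal equations. -/
lemma regress_eq_of_normal {X : Matrix (Fin n) (Fin p) ℝ} {m : ℕ} {i : Fin m → SignedVar p}
    (h : Indep X i) {z c : Fin m → ℝ} (hc : ∀ b, ∑ a, signedGram X (i b) (i a) * c a = z b)
    (j : SignedVar p) : regress X i z j = ∑ a, signedGram X j (i a) * c a := by
  have hz : z = (signedGram X).submatrix i i *ᵥ c := by
    ext b
    simp [← hc b, Matrix.mulVec, dotProduct]
  rw [regress, hz, Matrix.mulVec_mulVec, Matrix.nonsing_inv_mul _ h.isUnit_det, Matrix.one_mulVec]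
  rfl

lemma exists_normal {X : Matrix (Fin n) (Fin p) ℝ} {m : ℕ} {i : Fin m → SignedVar p}
    (h : Indep X i) (z : Fin m → ℝ) :
    ∃ c : Fin m → ℝ, ∀ b, ∑ a, signedGram X (i b) (i a) * c a = z b := by
  refine ⟨((signedGram X).submatrix i i)⁻¹ *ᵥ z, fun b => ?_⟩
  have := congrFun (Matrix.mulVec_mulVec z ((signedGram X).submatrix i i)
    ((signedGram X).submatrix i i)⁻¹) b
  rw [Matrix.mul_nonsing_inv _ h.isUnit_det, Matrix.one_mulVec] at this
  simpa [Matrix.mulVec, dotProduct] using this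

lemma regress_sub_smul_one (X : Matrix (Fin n) (Fin p) ℝ) {m : ℕ} (i : Fin m → SignedVar p)
    (z : Fin m → ℝ) (l : ℝ) (j : SignedVar p) :
    regress X i (fun a => z a - l) j = regress X i z j - l * theta X i j := by
  have : (fun a => z a - l) = z - l • (fun _ => (1 : ℝ)) := by ext; simp
  simp only [theta, regress]
  rw [this, Matrix.mulVec_sub, Matrix.mulVec_smul, dotProduct_sub, dotProduct_smul, smul_eq_mul]

lemma regress_swap (X : Matrix (Fin n) (Fin p) ℝ) {m : ℕ} (i : Fin m → SignedVar p)
    (z : Fin m → ℝ) (j : SignedVar p) : regress X i z j.swap = -regress X i z j := by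
  simp [regress, signedGram_eq_inner, signedCol_swap, dotProduct, Finset.sum_neg_distrib]

lemma signedCorr_swap (X : Matrix (Fin n) (Fin p) ℝ) (y : EuclideanSpace ℝ (Fin n))
    (j : SignedVar p) : signedCorr X y j.swap = -signedCorr X y j := by
  simp [← inner_signedCol, signedCol_swap]

/-- The orthogonal projection of the `j`-th signed column onto the span of the columns `i`, by the
normal equations. -/
def projCol (X : Matrix (Fin n) (Fin p) ℝ) {m : ℕ} (i : Fin m → SignedVar p) (j : SignedVar p) :
    EuclideanSpace ℝ (Fin n) :=
  ∑ a, (((signedGram X).submatrix i i)⁻¹ *ᵥ (fun b => signedGram X j (i b))) a • signedCol X (i a)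

/-- The component of the `j`-th signed column orthogonal to the columns `i`. -/
def perpCol (X : Matrix (Fin n) (Fin p) ℝ) {m : ℕ} (i : Fin m → SignedVar p) (j : SignedVar p) :
    EuclideanSpace ℝ (Fin n) :=
  signedCol X j - projCol X i j

lemma regress_signedCorr (X : Matrix (Fin n) (Fin p) ℝ) {m : ℕ} (i : Fin m → SignedVar p)
    (y : EuclideanSpace ℝ (Fin n)) (j : SignedVar p) :
    regress X i (fun a => signedCorr X y (i a)) j = ⟪projCol X i j, y⟫_ℝ := by
  have hsymm : ((signedGram X).submatrix i i)ᵀ = (signedGram X).submatrix i i := by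
    ext a b
    simp [signedGram_comm X (i b) (i a)]
  rw [regress, projCol, sum_inner, Matrix.dotProduct_mulVec, ← Matrix.mulVec_transpose,
    Matrix.transpose_nonsing_inv, hsymm]
  simp [dotProduct, inner_smul_left, inner_signedCol]

lemma inner_perpCol (X : Matrix (Fin n) (Fin p) ℝ) {m : ℕ} (i : Fin m → SignedVar p)
    (y : EuclideanSpace ℝ (Fin n)) (j : SignedVar p) :
    ⟪perpCol X i j, y⟫_ℝ =
      signedCorr X y j - regress X i (fun a => signedCorr X y (i a)) j := by
  rw [perpCol, inner_sub_left, inner_signedCol, regress_signedCorr]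

lemma perpCol_swap (X : Matrix (Fin n) (Fin p) ℝ) {m : ℕ} (i : Fin m → SignedVar p)
    (j : SignedVar p) : perpCol X i j.swap = -perpCol X i j := by
  refine ext_inner_right ℝ fun y => ?_
  rw [inner_neg_left, inner_perpCol, inner_perpCol, signedCorr_swap, regress_swap]
  ring

lemma signedCorr_signedCol (X : Matrix (Fin n) (Fin p) ℝ) (i j : SignedVar p) :
    signedCorr X (signedCol X i) j = signedGram X i j := by
  rw [← inner_signedCol, signedGram_eq_inner, real_inner_comm]

lemma inner_perpCol_active {X : Matrix (Fin n) (Fin p) ℝ} {m : ℕ} {i : Fin m → SignedVar p}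
    (h : Indep X i) (j : SignedVar p) (a : Fin m) :
    ⟪perpCol X i j, signedCol X (i a)⟫_ℝ = 0 := by
  rw [inner_perpCol]
  have := regress_eq_of_normal (X := X) h
    (z := fun b => signedCorr X (signedCol X (i a)) (i b)) (c := Pi.single a 1) (j := j)
    (fun b => by
      simp [signedCorr_signedCol, Pi.single_apply, signedGram_comm X (i b)])
  rw [this]
  simp [signedCorr_signedCol, Pi.single_apply, signedGram_comm X j]

lemma projCol_mem_span (X : Matrix (Fin n) (Fin p) ℝ) {m : ℕ} (i : Fin m → SignedVar p)
    (j : SignedVar p) :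
    projCol X i j ∈ Submodule.span ℝ (Set.range fun a => signedCol X (i a)) :=
  Submodule.sum_mem _ fun a _ => Submodule.smul_mem _ _ (Submodule.subset_span ⟨a, rfl⟩)

lemma inner_perpCol_of_mem_span {X : Matrix (Fin n) (Fin p) ℝ} {m : ℕ} {i : Fin m → SignedVar p}
    (h : Indep X i) (j : SignedVar p) {v : EuclideanSpace ℝ (Fin n)}
    (hv : v ∈ Submodule.span ℝ (Set.range fun a => signedCol X (i a))) :
    ⟪perpCol X i j, v⟫_ℝ = 0 := by
  induction hv using Submodule.span_induction with
  | mem x hx => obtain ⟨a, rfl⟩ := hx; exact inner_perpCol_active h j a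
  | zero => simp
  | add x y _ _ hx hy => rw [inner_add_right, hx, hy, add_zero]
  | smul c x _ hx => rw [inner_smul_right, hx, mul_zero]

lemma perpCol_eq_zero_iff {X : Matrix (Fin n) (Fin p) ℝ} {m : ℕ} {i : Fin m → SignedVar p}
    (h : Indep X i) (j : SignedVar p) :
    perpCol X i j = 0 ↔
      signedCol X j ∈ Submodule.span ℝ (Set.range fun a => signedCol X (i a)) := by
  constructor
  · intro h0
    rw [perpCol, sub_eq_zero] at h0
    rw [h0]
    exact projCol_mem_span X i j
  · intro hj
    have : perpCol X i j ∈ Submodule.span ℝ (Set.range fun a => signedCol X (i a)) :=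
      Submodule.sub_mem _ hj (projCol_mem_span X i j)
    exact inner_self_eq_zero.1 (inner_perpCol_of_mem_span h j this)

/-- The vector whose inner product with `y` is the level at which the residual correlation of `j`
meets the common one of the active variables `i`. -/
def knotVec (X : Matrix (Fin n) (Fin p) ℝ) {m : ℕ} (i : Fin m → SignedVar p) (j : SignedVar p) :
    EuclideanSpace ℝ (Fin n) :=
  (1 - theta X i j)⁻¹ • perpCol X i j

lemma inner_knotVec (X : Matrix (Fin n) (Fin p) ℝ) {m : ℕ} (i : Fin m → SignedVar p)
    (y : EuclideanSpace ℝ (Fin n)) (j : SignedVar p) :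
    ⟪knotVec X i j, y⟫_ℝ =
      (signedCorr X y j - regress X i (fun a => signedCorr X y (i a)) j) / (1 - theta X i j) := by
  rw [knotVec, real_inner_smul_left, inner_perpCol]
  ring

lemma inner_knotVec_of_mem_span {X : Matrix (Fin n) (Fin p) ℝ} {m : ℕ} {i : Fin m → SignedVar p}
    (h : Indep X i) (j : SignedVar p) {v : EuclideanSpace ℝ (Fin n)}
    (hv : v ∈ Submodule.span ℝ (Set.range fun a => signedCol X (i a))) :
    ⟪knotVec X i j, v⟫_ℝ = 0 := by
  rw [knotVec, real_inner_smul_left, inner_perpCol_of_mem_span h j hv, mul_zero]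

/-! ### Prefixes of a sequence of signed variables -/

/-- The first `k` terms of a sequence. -/
def pre {α : Type*} (i : ℕ → α) (k : ℕ) : Fin k → α := fun a => i a

lemma pre_succ {α : Type*} (i : ℕ → α) (k : ℕ) :
    pre i (k + 1) = Fin.snoc (α := fun _ => α) (pre i k) (i k) := by
  ext a
  refine Fin.lastCases ?_ (fun b => ?_) a <;> simp [pre]

lemma pre_congr_of_le {α : Type*} {i i' : ℕ → α} {k K : ℕ} (hk : k ≤ K)
    (h : pre i K = pre i' K) : pre i k = pre i' k := by
  ext a
  exact congrFun h ⟨a, a.2.trans_le hk⟩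

lemma exists_pre_eq {α : Type*} [Nonempty α] {K : ℕ} (i : Fin K → α) :
    ∃ i' : ℕ → α, pre i' K = i :=
  ⟨fun k => if h : k < K then i ⟨k, h⟩ else Classical.arbitrary α, by ext a; simp [pre]⟩

lemma mem_inactive_pre {i : ℕ → SignedVar p} {k : ℕ} {j : SignedVar p} :
    j ∈ inactive (pre i k) ↔ ∀ a < k, var j ≠ var (i a) := by
  rw [mem_inactive]
  exact ⟨fun h a ha => h ⟨a, ha⟩, fun h a => h a a.2⟩

lemma inactive_pre_anti (i : ℕ → SignedVar p) {k l : ℕ} (hkl : k ≤ l) :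
    inactive (pre i l) ⊆ inactive (pre i k) := fun j hj => by
  rw [mem_inactive_pre] at hj ⊢
  exact fun a ha => hj a (ha.trans_le hkl)

lemma Indep.pre_of_le {X : Matrix (Fin n) (Fin p) ℝ} {i : ℕ → SignedVar p} {k l : ℕ}
    (h : Indep X (pre i l)) (hkl : k ≤ l) : Indep X (pre i k) :=
  LinearIndependent.comp h (Fin.castLE hkl) (Fin.castLE_injective hkl)

lemma indep_pre_succ_iff {X : Matrix (Fin n) (Fin p) ℝ} {i : ℕ → SignedVar p} {k : ℕ} :
    Indep X (pre i (k + 1)) ↔ Indep X (pre i k) ∧ perpCol X (pre i k) (i k) ≠ 0 := by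
  have : (fun a => signedCol X (pre i (k + 1) a)) =
      Fin.snoc (α := fun _ => EuclideanSpace ℝ (Fin n))
        (fun a => signedCol X (pre i k a)) (signedCol X (i k)) := by
    rw [pre_succ]
    funext a
    refine Fin.lastCases ?_ (fun b => ?_) a <;> simp
  rw [Indep, this, linearIndependent_finSnoc]
  refine and_congr_right fun h => not_congr ?_
  rw [perpCol_eq_zero_iff h]

lemma mem_inactive_of_perpCol_ne_zero {X : Matrix (Fin n) (Fin p) ℝ} {m : ℕ}
    {i : Fin m → SignedVar p} (h : Indep X i) {j : SignedVar p} (hj : perpCol X i j ≠ 0) :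
    j ∈ inactive i := by
  rw [mem_inactive]
  intro a ha
  refine hj ((perpCol_eq_zero_iff h j).2 ?_)
  have ha' : signedCol X (i a) ∈ Submodule.span ℝ (Set.range fun a => signedCol X (i a)) :=
    Submodule.subset_span ⟨a, rfl⟩
  rcases eq_or_eq_swap_of_var_eq ha with h | h
  · rwa [h]
  · rw [h, signedCol_swap]
    exact Submodule.neg_mem _ ha'

/-! ### Residual correlations along a prescribed path -/

/-- The residual correlation of `j` at level `l` when the variables `i₁, …, i_k` are active. -/
def corrAt (X : Matrix (Fin n) (Fin p) ℝ) (y : EuclideanSpace ℝ (Fin n)) {k : ℕ}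
    (i : Fin k → SignedVar p) (l : ℝ) (j : SignedVar p) : ℝ :=
  signedCorr X y j - regress X i (fun a => signedCorr X y (i a) - l) j

lemma corrAt_eq (X : Matrix (Fin n) (Fin p) ℝ) (y : EuclideanSpace ℝ (Fin n)) {k : ℕ}
    (i : Fin k → SignedVar p) (l : ℝ) (j : SignedVar p) :
    corrAt X y i l j =
      signedCorr X y j - regress X i (fun a => signedCorr X y (i a)) j + l * theta X i j := by
  rw [corrAt, regress_sub_smul_one]
  ring

lemma corrAt_swap (X : Matrix (Fin n) (Fin p) ℝ) (y : EuclideanSpace ℝ (Fin n)) {k : ℕ}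
    (i : Fin k → SignedVar p) (l : ℝ) (j : SignedVar p) :
    corrAt X y i l j.swap = -corrAt X y i l j := by
  rw [corrAt, corrAt, signedCorr_swap, regress_swap]
  ring

lemma corrAt_sub_self {X : Matrix (Fin n) (Fin p) ℝ} (y : EuclideanSpace ℝ (Fin n)) {k : ℕ}
    {i : Fin k → SignedVar p} {j : SignedVar p} (hj : theta X i j < 1) (l : ℝ) :
    corrAt X y i l j - l = (1 - theta X i j) * (⟪knotVec X i j, y⟫_ℝ - l) := by
  have : 1 - theta X i j ≠ 0 := by linarith
  rw [corrAt_eq, inner_knotVec]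
  field_simp
  ring

lemma corrAt_le_iff {X : Matrix (Fin n) (Fin p) ℝ} (y : EuclideanSpace ℝ (Fin n)) {k : ℕ}
    {i : Fin k → SignedVar p} {j : SignedVar p} (hj : theta X i j < 1) (l : ℝ) :
    corrAt X y i l j ≤ l ↔ ⟪knotVec X i j, y⟫_ℝ ≤ l := by
  rw [← sub_nonpos, corrAt_sub_self y hj, ← sub_nonpos (b := l)]
  exact mul_nonpos_iff_pos_imp_nonpos.trans
    ⟨fun h => h.1 (by linarith), fun h => ⟨fun _ => h, fun _ => by linarith⟩⟩

lemma corrAt_lt_iff {X : Matrix (Fin n) (Fin p) ℝ} (y : EuclideanSpace ℝ (Fin n)) {k : ℕ}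
    {i : Fin k → SignedVar p} {j : SignedVar p} (hj : theta X i j < 1) (l : ℝ) :
    corrAt X y i l j < l ↔ ⟪knotVec X i j, y⟫_ℝ < l := by
  rw [← sub_neg, corrAt_sub_self y hj, ← sub_neg (b := l)]
  have h0 : 0 < 1 - theta X i j := by linarith
  exact ⟨fun h => lt_of_not_ge fun h' => h.not_ge (mul_nonneg h0.le h'),
    fun h => mul_neg_of_pos_of_neg h0 h⟩

lemma corrAt_eq_iff {X : Matrix (Fin n) (Fin p) ℝ} (y : EuclideanSpace ℝ (Fin n)) {k : ℕ}
    {i : Fin k → SignedVar p} {j : SignedVar p} (hj : theta X i j < 1) (l : ℝ) :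
    corrAt X y i l j = l ↔ ⟪knotVec X i j, y⟫_ℝ = l := by
  rw [← sub_eq_zero, corrAt_sub_self y hj, ← sub_eq_zero (b := l), mul_eq_zero]
  exact ⟨fun h => h.resolve_left (by linarith), Or.inr⟩

/-- Continuity of the path at a knot: activating the variable `i_{k+1}` at the level where its
residual correlation equals that level does not change the residual correlations, since the
enlarged normal equations are solved by the old coefficients padded with a zero. -/
lemma corrAt_succ {X : Matrix (Fin n) (Fin p) ℝ} {y : EuclideanSpace ℝ (Fin n)}
    {i : ℕ → SignedVar p} {k : ℕ} (h : Indep X (pre i (k + 1))) {l : ℝ}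
    (hl : corrAt X y (pre i k) l (i k) = l) (j : SignedVar p) :
    corrAt X y (pre i (k + 1)) l j = corrAt X y (pre i k) l j := by
  have hk : Indep X (pre i k) := h.pre_of_le k.le_succ
  obtain ⟨c, hc⟩ := exists_normal hk (fun a => signedCorr X y (pre i k a) - l)
  have h1 : ∀ j, regress X (pre i k) (fun a => signedCorr X y (pre i k a) - l) j
      = ∑ a, signedGram X j (pre i k a) * c a := regress_eq_of_normal hk hc
  have h2 := regress_eq_of_normal h (z := fun a => signedCorr X y (pre i (k + 1) a) - l)
    (c := Fin.snoc (α := fun _ => ℝ) c 0) (j := j) (fun b => by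
      rw [pre_succ, Fin.sum_univ_castSucc]
      refine Fin.lastCases ?_ (fun b => ?_) b
      · simp only [Fin.snoc_castSucc, Fin.snoc_last, mul_zero, add_zero]
        rw [← h1]
        rw [corrAt] at hl
        linarith
      · simp only [Fin.snoc_castSucc, Fin.snoc_last, mul_zero, add_zero]
        exact hc b)
  rw [corrAt, corrAt, h1, h2, Fin.sum_univ_castSucc, pre_succ]
  simp

/-! ### The LAR path under the Irrepresentable Check -/

/-- The Irrepresentable Check in terms of `θ`: inactive variables have `θ_j < 1` at each of the
first `K` steps. -/
def ThetaLtOne (X : Matrix (Fin n) (Fin p) ℝ) (i : ℕ → SignedVar p) (K : ℕ) : Prop :=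
  ∀ k ≤ K, ∀ j ∈ inactive (pre i k), theta X (pre i k) j < 1

lemma theta_eq_sgn_mul (X : Matrix (Fin n) (Fin p) ℝ) {k : ℕ} (i : Fin k → SignedVar p)
    (j : SignedVar p) :
    theta X i j = sgn j * (X.col (var j) ⬝ᵥ
      (X.submatrix id (fun a => var (i a)) *ᵥ
        (((X.submatrix id (fun a => var (i a)))ᵀ * X.submatrix id (fun a => var (i a)))⁻¹ *ᵥ
          fun a => sgn (i a)))) := by
  set XT := X.submatrix id (fun a => var (i a))
  set D : Matrix (Fin k) (Fin k) ℝ := Matrix.diagonal fun a => sgn (i a) with hD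
  have hgram : ∀ i j, signedGram X i j = sgn i * sgn j * (X.col (var i) ⬝ᵥ X.col (var j)) := by
    intro i j
    cases i <;> cases j <;> simp [signedGram, sgn, var, Matrix.mul_apply, dotProduct]
  have hsq : ∀ j : SignedVar p, sgn j * sgn j = 1 := by
    intro j; cases j <;> simp [sgn]
  have hDD : D * D = 1 := by
    rw [hD, Matrix.diagonal_mul_diagonal]
    simp [hsq]
  have hDinv : D⁻¹ = D := Matrix.inv_eq_left_inv hDD
  have hM : (signedGram X).submatrix i i = D * (XTᵀ * XT) * D := by
    ext a b
    rw [hD, Matrix.mul_diagonal, Matrix.diagonal_mul]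
    simp only [Matrix.submatrix_apply, hgram, XT, Matrix.mul_apply, dotProduct,
      Matrix.transpose_apply, Matrix.col_apply, id]
    ring
  have hR : (fun a => signedGram X j (i a)) = sgn j • (X.col (var j) ᵥ* (XT * D)) := by
    ext a
    simp only [hgram, hD, Matrix.vecMul, Pi.smul_apply, smul_eq_mul, dotProduct,
      Matrix.mul_diagonal, XT, Matrix.submatrix_apply, Matrix.col_apply, id, Finset.mul_sum]
    exact Finset.sum_congr rfl fun _ _ => by ring
  have hone : D *ᵥ (fun _ => (1 : ℝ)) = fun a => sgn (i a) := by
    ext a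
    simp [hD, Matrix.mulVec_diagonal]
  rw [theta, regress, hR, hM, Matrix.mul_inv_rev, Matrix.mul_inv_rev, hDinv, smul_dotProduct,
    ← Matrix.dotProduct_mulVec, Matrix.mulVec_mulVec, ← Matrix.mul_assoc, Matrix.mul_assoc XT D,
    hDD, Matrix.mul_one, ← Matrix.mul_assoc, ← Matrix.mulVec_mulVec, hone,
    ← Matrix.mulVec_mulVec, smul_eq_mul]

lemma abs_sgn (j : SignedVar p) : |sgn j| = 1 := by cases j <;> simp [sgn]

lemma IrrCheck.thetaLtOne {X : Matrix (Fin n) (Fin p) ℝ} {i : ℕ → SignedVar p} {K : ℕ}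
    (h : IrrCheck X (pre i K)) : ThetaLtOne X i K := by
  intro k hk j hj
  rcases Nat.eq_zero_or_pos k with rfl | hk0
  · simp [theta, regress]
  · have := h k hk0 hk (var j) (fun a => mem_inactive.1 hj a)
    refine lt_of_le_of_lt (le_abs_self _) ?_
    rw [theta_eq_sgn_mul, abs_mul, abs_sgn, one_mul]
    exact this

lemma ThetaLtOne.mono {X : Matrix (Fin n) (Fin p) ℝ} {i : ℕ → SignedVar p} {k K : ℕ}
    (h : ThetaLtOne X i K) (hk : k ≤ K) : ThetaLtOne X i k := fun m hm => h m (hm.trans hk)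

lemma ThetaLtOne.congr {X : Matrix (Fin n) (Fin p) ℝ} {i i' : ℕ → SignedVar p} {K : ℕ}
    (h : ThetaLtOne X i K) (hi : pre i K = pre i' K) : ThetaLtOne X i' K := fun m hm => by
  rw [← pre_congr_of_le hm hi]
  exact h m hm

/-- The observations for which the path does not stop within the first `K` steps: no family of at
most `K` independent columns fits `y` perfectly as seen from the remaining columns. -/
def Unfitted (X : Matrix (Fin n) (Fin p) ℝ) (K : ℕ) (y : EuclideanSpace ℝ (Fin n)) : Prop :=
  ∀ m ≤ K, ∀ i : Fin m → SignedVar p, Indep X i → ∃ j ∈ inactive i, ⟪perpCol X i j, y⟫_ℝ ≠ 0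

lemma Unfitted.exists_pos {X : Matrix (Fin n) (Fin p) ℝ} {K : ℕ} {y : EuclideanSpace ℝ (Fin n)}
    (h : Unfitted X K y) {i : ℕ → SignedVar p} {k : ℕ} (hk : k ≤ K) (hi : Indep X (pre i k))
    (hθ : ∀ j ∈ inactive (pre i k), theta X (pre i k) j < 1) :
    ∃ j ∈ inactive (pre i k), 0 < ⟪knotVec X (pre i k) j, y⟫_ℝ := by
  obtain ⟨j, hj, hne⟩ := h k hk _ hi
  rcases lt_or_gt_of_ne hne with h0 | h0
  · have hs := swap_mem_inactive hj
    refine ⟨j.swap, hs, ?_⟩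
    rw [knotVec, real_inner_smul_left, perpCol_swap, inner_neg_left]
    exact mul_pos (inv_pos.2 (sub_pos.2 (hθ _ hs))) (neg_pos.2 h0)
  · refine ⟨j, hj, ?_⟩
    rw [knotVec, real_inner_smul_left]
    exact mul_pos (inv_pos.2 (sub_pos.2 (hθ _ hj))) h0

/-- The sequence `î₁, î₂, …` of signed variables along the path. -/
def path (tie : Finset (SignedVar p) → SignedVar p) (X : Matrix (Fin n) (Fin p) ℝ)
    (y : EuclideanSpace ℝ (Fin n)) : ℕ → SignedVar p :=
  fun k => (state tie X y k).vars (Fin.last k)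

lemma state_vars (tie : Finset (SignedVar p) → SignedVar p) (X : Matrix (Fin n) (Fin p) ℝ)
    (y : EuclideanSpace ℝ (Fin n)) (k : ℕ) :
    (state tie X y k).vars = pre (path tie X y) (k + 1) := by
  induction k with
  | zero => funext a; rw [show a = Fin.last 0 from Fin.ext (by omega)]; rfl
  | succ k ih =>
    rw [pre_succ, ← ih]
    have : path tie X y (k + 1) = (state tie X y (k + 1)).vars (Fin.last _) := rfl
    rw [this]
    simp [state, step]

/-- The state of the path when `i_{k+1}` enters: its residual correlation is the knot, which no
residual correlation of an inactive variable exceeds. -/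
structure PathSpec (tie : Finset (SignedVar p) → SignedVar p) (X : Matrix (Fin n) (Fin p) ℝ)
    (y : EuclideanSpace ℝ (Fin n)) (k : ℕ) : Prop where
  resid_eq : ∀ j, (state tie X y k).resid j = corrAt X y (pre (path tie X y) k) (knot tie X y k) j
  knot_pos : 0 < knot tie X y k
  mem_inactive : path tie X y k ∈ inactive (pre (path tie X y) k)
  corrAt_path : corrAt X y (pre (path tie X y) k) (knot tie X y k) (path tie X y k) =
    knot tie X y k
  corrAt_le : ∀ j ∈ inactive (pre (path tie X y) k),
    corrAt X y (pre (path tie X y) k) (knot tie X y k) j ≤ knot tie X y k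
  indep : Indep X (pre (path tie X y) (k + 1))

section

variable {tie : Finset (SignedVar p) → SignedVar p} {X : Matrix (Fin n) (Fin p) ℝ}
  {y : EuclideanSpace ℝ (Fin n)} {K : ℕ}

lemma perpCol_ne_zero_of_inner_knotVec_pos {k : ℕ} {i : Fin k → SignedVar p} {j : SignedVar p}
    (h : 0 < ⟪knotVec X i j, y⟫_ℝ) : perpCol X i j ≠ 0 := by
  intro h0
  simp [knotVec, h0] at h

lemma indep_of_isEmpty (X : Matrix (Fin n) (Fin p) ℝ) (i : Fin 0 → SignedVar p) : Indep X i :=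
  linearIndependent_empty_type

lemma theta_zero (X : Matrix (Fin n) (Fin p) ℝ) (i : Fin 0 → SignedVar p) (j : SignedVar p) :
    theta X i j = 0 := by
  simp [theta, regress]

lemma corrAt_zero (X : Matrix (Fin n) (Fin p) ℝ) (y : EuclideanSpace ℝ (Fin n))
    (i : Fin 0 → SignedVar p) (l : ℝ) (j : SignedVar p) : corrAt X y i l j = signedCorr X y j := by
  simp [corrAt, regress]

lemma pathSpec_zero (htie : ∀ s : Finset (SignedVar p), s.Nonempty → tie s ∈ s)
    (hy : Unfitted X K y) : PathSpec tie X y 0 := by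
  set î := path tie X y
  have hθ : ∀ j ∈ inactive (pre î 0), theta X (pre î 0) j < 1 := fun j _ => by
    rw [theta_zero]; norm_num
  obtain ⟨j₀, hj₀, hpos⟩ := hy.exists_pos (Nat.zero_le K) (indep_of_isEmpty X _) hθ
  have hne : (argmaxOn Finset.univ (signedCorr X y)).Nonempty := by
    obtain ⟨j, -, hj⟩ := Finset.exists_max_image Finset.univ (signedCorr X y) ⟨j₀, by simp⟩
    exact ⟨j, mem_argmaxOn.2 ⟨by simp, hj⟩⟩
  have hmax : ∀ j, signedCorr X y j ≤ signedCorr X y (î 0) := fun j =>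
    (mem_argmaxOn.1 (htie _ hne)).2 j (by simp)
  have : Nonempty (SignedVar p) := ⟨j₀⟩
  have hknot : knot tie X y 0 = signedCorr X y (î 0) :=
    le_antisymm (ciSup_le hmax) (le_ciSup (Set.finite_range _).bddAbove _)
  have hj₀' : 0 < signedCorr X y j₀ := by
    have h := (corrAt_lt_iff y (hθ j₀ hj₀) 0).not.2 hpos.not_gt
    have h' := (corrAt_eq_iff y (hθ j₀ hj₀) 0).not.2 hpos.ne'
    rw [corrAt_zero] at h h'
    exact lt_of_le_of_ne (not_lt.1 h) (Ne.symm h')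
  have hk0 : 0 < knot tie X y 0 := hknot ▸ hj₀'.trans_le (hmax j₀)
  have hmem : î 0 ∈ inactive (pre î 0) := by simp [mem_inactive_pre]
  have hpath : corrAt X y (pre î 0) (knot tie X y 0) (î 0) = knot tie X y 0 := by
    rw [corrAt_zero, hknot]
  refine ⟨fun j => ?_, hk0, hmem, hpath, fun j _ => ?_, ?_⟩
  · rw [corrAt_zero]; rfl
  · rw [corrAt_zero, hknot]; exact hmax j
  · refine indep_pre_succ_iff.2 ⟨indep_of_isEmpty X _, ?_⟩
    rw [corrAt_eq_iff y (hθ _ hmem)] at hpath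
    exact perpCol_ne_zero_of_inner_knotVec_pos (hpath ▸ hk0)

lemma PathSpec.residAt_eq {k : ℕ} (h : PathSpec tie X y k) (l : ℝ) (j : SignedVar p) :
    residAt X (state tie X y k) l j = corrAt X y (pre (path tie X y) (k + 1)) l j := by
  rw [residAt, h.resid_eq, ← corrAt_succ h.indep h.corrAt_path, corrAt_eq, corrAt_eq, state_vars]
  simp only [knot]
  ring

/-- The next knot is the largest of the levels at which an inactive variable may enter: the slope
`1 - θ_j > 0` makes `N_j(l) - l` monotone, so that each variable meets the level once, below the
current knot. -/
lemma PathSpec.isGreatest_knot_succ {k : ℕ} (h : PathSpec tie X y k) (hy : Unfitted X K y)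
    (hk : k + 1 ≤ K) (hθ : ThetaLtOne X (path tie X y) (k + 1)) :
    IsGreatest ((fun j => ⟪knotVec X (pre (path tie X y) (k + 1)) j, y⟫_ℝ) ''
        (inactive (pre (path tie X y) (k + 1)) : Set (SignedVar p))) (knot tie X y (k + 1)) ∧
      0 < knot tie X y (k + 1) := by
  set î := path tie X y
  have hθ' := hθ (k + 1) le_rfl
  obtain ⟨j₀, hj₀, hpos⟩ := hy.exists_pos hk h.indep hθ'
  obtain ⟨j, hj, hmax⟩ := Finset.exists_max_image (inactive (pre î (k + 1)))
    (fun j => ⟪knotVec X (pre î (k + 1)) j, y⟫_ℝ) ⟨j₀, hj₀⟩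
  have hle : ∀ j' ∈ inactive (pre î (k + 1)),
      ⟪knotVec X (pre î (k + 1)) j', y⟫_ℝ ≤ knot tie X y k := fun j' hj' => by
    rw [← corrAt_le_iff y (hθ' j' hj'), corrAt_succ h.indep h.corrAt_path]
    exact h.corrAt_le j' (inactive_pre_anti î k.le_succ hj')
  have hgr : IsGreatest {l : ℝ | 0 < l ∧ l ≤ (state tie X y k).knot ∧
      ∃ j ∈ inactive (state tie X y k).vars, residAt X (state tie X y k) l j = l}
      ⟪knotVec X (pre î (k + 1)) j, y⟫_ℝ := by
    rw [state_vars]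
    constructor
    · refine ⟨hpos.trans_le (hmax j₀ hj₀), hle j hj, j, hj, ?_⟩
      rw [h.residAt_eq, corrAt_eq_iff y (hθ' j hj)]
    · rintro l ⟨-, -, j', hj', hl⟩
      rw [h.residAt_eq, corrAt_eq_iff y (hθ' j' hj')] at hl
      exact hl ▸ hmax j' hj'
  have hknot : knot tie X y (k + 1) = ⟪knotVec X (pre î (k + 1)) j, y⟫_ℝ := hgr.csSup_eq
  rw [hknot]
  refine ⟨⟨⟨j, hj, rfl⟩, ?_⟩, hgr.1.1⟩
  rintro _ ⟨j', hj', rfl⟩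
  exact hmax j' hj'

lemma PathSpec.succ (htie : ∀ s : Finset (SignedVar p), s.Nonempty → tie s ∈ s) {k : ℕ}
    (h : PathSpec tie X y k) (hy : Unfitted X K y)
    (hk : k + 1 ≤ K) (hθ : ThetaLtOne X (path tie X y) (k + 1)) : PathSpec tie X y (k + 1) := by
  obtain ⟨⟨⟨j, hj, hjk⟩, hub⟩, hpos⟩ := h.isGreatest_knot_succ hy hk hθ
  set î := path tie X y
  have hθ' := hθ (k + 1) le_rfl
  have hle : ∀ j' ∈ inactive (pre î (k + 1)),
      corrAt X y (pre î (k + 1)) (knot tie X y (k + 1)) j' ≤ knot tie X y (k + 1) :=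
    fun j' hj' => (corrAt_le_iff y (hθ' j' hj') _).2 (hub ⟨j', hj', rfl⟩)
  have hjeq : corrAt X y (pre î (k + 1)) (knot tie X y (k + 1)) j = knot tie X y (k + 1) :=
    (corrAt_eq_iff y (hθ' j hj) _).2 hjk
  have hres : ∀ j', residAt X (state tie X y k) (nextKnot X (state tie X y k)) j' =
      corrAt X y (pre î (k + 1)) (knot tie X y (k + 1)) j' := fun j' => h.residAt_eq _ j'
  have hpath : î (k + 1) = tie (argmaxOn (inactive (state tie X y k).vars)
      (residAt X (state tie X y k) (nextKnot X (state tie X y k)))) := by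
    simp [î, path, state, step]
  have hne : (argmaxOn (inactive (state tie X y k).vars)
      (residAt X (state tie X y k) (nextKnot X (state tie X y k)))).Nonempty := by
    refine ⟨j, mem_argmaxOn.2 ⟨by rwa [state_vars], fun j' hj' => ?_⟩⟩
    rw [state_vars] at hj'
    rw [hres, hres, hjeq]
    exact hle j' hj'
  obtain ⟨hmem, hmax⟩ := mem_argmaxOn.1 (htie _ hne)
  rw [← hpath, state_vars] at hmem
  rw [← hpath] at hmax
  have hcorr : corrAt X y (pre î (k + 1)) (knot tie X y (k + 1)) (î (k + 1)) =
      knot tie X y (k + 1) := by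
    refine le_antisymm (hle _ hmem) ?_
    have := hmax j (by rwa [state_vars])
    rwa [hres, hres, hjeq] at this
  refine ⟨fun j' => hres j', hpos, hmem, hcorr, hle, indep_pre_succ_iff.2 ⟨h.indep, ?_⟩⟩
  rw [corrAt_eq_iff y (hθ' _ hmem)] at hcorr
  exact perpCol_ne_zero_of_inner_knotVec_pos (hcorr ▸ hpos)

lemma pathSpec (htie : ∀ s : Finset (SignedVar p), s.Nonempty → tie s ∈ s)
    (hy : Unfitted X K y) {k : ℕ} (hk : k ≤ K) (hθ : ThetaLtOne X (path tie X y) k) :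
    PathSpec tie X y k := by
  induction k with
  | zero => exact pathSpec_zero htie hy
  | succ k ih => exact (ih (k.le_succ.trans hk) (hθ.mono k.le_succ)).succ htie hy hk hθ

lemma PathSpec.knot_eq {k : ℕ} (h : PathSpec tie X y k)
    (hθ : ∀ j ∈ inactive (pre (path tie X y) k), theta X (pre (path tie X y) k) j < 1) :
    knot tie X y k = ⟪knotVec X (pre (path tie X y) k) (path tie X y k), y⟫_ℝ :=
  ((corrAt_eq_iff y (hθ _ h.mem_inactive) _).1 h.corrAt_path).symm

lemma PathSpec.inner_knotVec_le {k : ℕ} (h : PathSpec tie X y k)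
    (hθ : ∀ j ∈ inactive (pre (path tie X y) k), theta X (pre (path tie X y) k) j < 1)
    {j : SignedVar p} (hj : j ∈ inactive (pre (path tie X y) k)) :
    ⟪knotVec X (pre (path tie X y) k) j, y⟫_ℝ ≤ knot tie X y k :=
  (corrAt_le_iff y (hθ _ hj) _).1 (h.corrAt_le j hj)

lemma PathSpec.knot_succ_le {k : ℕ} (h : PathSpec tie X y k) (h' : PathSpec tie X y (k + 1))
    (hθ : ThetaLtOne X (path tie X y) (k + 1)) : knot tie X y (k + 1) ≤ knot tie X y k := by
  rw [h'.knot_eq (hθ _ le_rfl), ← corrAt_le_iff y (hθ _ le_rfl _ h'.mem_inactive),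
    corrAt_succ h.indep h.corrAt_path]
  exact h.corrAt_le _ (inactive_pre_anti _ k.le_succ h'.mem_inactive)

/-- The deterministic heart of the selection event, run backwards along a prescribed sequence `i`:
if the levels `⟪knotVec (i₁, …, i_{k-1}) i_k, y⟫` decrease strictly and end above every level of
the variables outside `i`, then at each step `i_{k+1}` strictly beats the other inactive ones. -/
lemma inner_knotVec_lt_of_ordered {i : ℕ → SignedVar p} (hi : Indep X (pre i K))
    (hθ : ThetaLtOne X i K) {g : ℕ → ℝ}
    (hg : ∀ k < K, g k = ⟪knotVec X (pre i k) (i k), y⟫_ℝ)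
    (hanti : ∀ k < K, g (k + 1) < g k) (hpos : 0 < g K)
    (hK : ∀ j ∈ inactive (pre i K), ⟪knotVec X (pre i K) j, y⟫_ℝ ≤ g K) {k : ℕ} (hk : k ≤ K) :
    0 < g k ∧ (∀ j ∈ inactive (pre i k), ⟪knotVec X (pre i k) j, y⟫_ℝ ≤ g k) ∧
      (k < K → ∀ j ∈ inactive (pre i k), j ≠ i k → ⟪knotVec X (pre i k) j, y⟫_ℝ < g k) := by
  induction hk using Nat.decreasingInduction with
  | self => exact ⟨hpos, hK, fun h => absurd h (lt_irrefl _)⟩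
  | of_succ k hk ih =>
    obtain ⟨hpos', hle, -⟩ := ih
    have hgpos : 0 < g k := hpos'.trans (hanti k hk)
    have hind : Indep X (pre i (k + 1)) := hi.pre_of_le hk
    have hmem : i k ∈ inactive (pre i k) :=
      mem_inactive_of_perpCol_ne_zero (hi.pre_of_le hk.le) (indep_pre_succ_iff.1 hind).2
    have hθk := hθ k hk.le
    have hcorr : corrAt X y (pre i k) (g k) (i k) = g k :=
      (corrAt_eq_iff y (hθk _ hmem) _).2 (hg k hk).symm
    have hlt : ∀ j ∈ inactive (pre i k), j ≠ i k → ⟪knotVec X (pre i k) j, y⟫_ℝ < g k := by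
      intro j hj hne
      rw [← corrAt_lt_iff y (hθk j hj)]
      by_cases hj' : j ∈ inactive (pre i (k + 1))
      · rw [← corrAt_succ hind hcorr, corrAt_lt_iff y (hθ _ hk j hj')]
        exact (hle j hj').trans_lt (hanti k hk)
      · -- the only other variable that stops being inactive is `i_{k+1}` with the opposite sign
        have hv : var j = var (i k) := by
          rw [mem_inactive_pre] at hj hj'
          push Not at hj'
          obtain ⟨a, ha, hja⟩ := hj'
          rcases Nat.lt_succ_iff_lt_or_eq.1 ha with h | rfl
          · exact absurd hja (hj a h)
          · exact hja
        have hj2 := (eq_or_eq_swap_of_var_eq hv).resolve_left hne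
        rw [hj2, corrAt_swap, hcorr]
        linarith
    refine ⟨hgpos, fun j hj => ?_, fun _ => hlt⟩
    by_cases h : j = i k
    · rw [h, hg k hk]
    · exact (hlt j hj h).le

/-- If the levels along `i` decrease strictly and end above every level of the variables outside
`i`, then the path selects `i`. -/
lemma pre_path_eq_of_ordered (htie : ∀ s : Finset (SignedVar p), s.Nonempty → tie s ∈ s)
    (hy : Unfitted X K y) {i : ℕ → SignedVar p} (hi : Indep X (pre i K))
    (hθ : ThetaLtOne X i K) {g : ℕ → ℝ}
    (hg : ∀ k < K, g k = ⟪knotVec X (pre i k) (i k), y⟫_ℝ)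
    (hanti : ∀ k < K, g (k + 1) < g k) (hpos : 0 < g K)
    (hK : ∀ j ∈ inactive (pre i K), ⟪knotVec X (pre i K) j, y⟫_ℝ ≤ g K) {k : ℕ} (hk : k ≤ K) :
    pre (path tie X y) k = pre i k := by
  induction k with
  | zero => exact Subsingleton.elim _ _
  | succ k ih =>
    have ih := ih (k.le_succ.trans hk)
    have hθk : ThetaLtOne X (path tie X y) k := (hθ.mono (k.le_succ.trans hk)).congr ih.symm
    have hspec := pathSpec htie hy (k.le_succ.trans hk) hθk
    obtain ⟨-, hle, hlt⟩ := inner_knotVec_lt_of_ordered hi hθ hg hanti hpos hK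
      (k.le_succ.trans hk)
    have hmem : i k ∈ inactive (pre i k) :=
      mem_inactive_of_perpCol_ne_zero (hi.pre_of_le (k.le_succ.trans hk))
        (indep_pre_succ_iff.1 (hi.pre_of_le hk)).2
    rw [pre_succ, pre_succ, ih]
    congr 1
    by_contra hne
    have h1 := hspec.knot_eq (hθk k le_rfl)
    have h2 := hspec.inner_knotVec_le (hθk k le_rfl) (j := i k) (by rwa [ih])
    have h3 := hspec.mem_inactive
    rw [ih] at h1 h2 h3
    have h4 := hlt hk _ h3 hne
    rw [hg k hk] at h4
    linarith

end

/-! ### Measurability of the path -/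

instance : DiscreteMeasurableSpace (SignedVar p) where
  forall_measurableSet s := by
    rw [measurableSet_sum_iff]
    exact ⟨MeasurableSet.of_discrete, MeasurableSet.of_discrete⟩

lemma measurable_argmaxOn {α : Type*} [MeasurableSpace α] (s : Finset (SignedVar p))
    {f : α → SignedVar p → ℝ} (hf : ∀ j, Measurable fun a => f a j)
    (tie : Finset (SignedVar p) → SignedVar p) :
    Measurable fun a => tie (argmaxOn s (f a)) := by
  let _ : MeasurableSpace (Finset (SignedVar p)) := ⊤
  have : Measurable fun a => argmaxOn s (f a) := by
    refine measurable_to_countable' fun t => ?_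
    have : (fun a => argmaxOn s (f a)) ⁻¹' {t} =
        ⋂ j, {a | j ∈ t ↔ (j ∈ s ∧ ∀ j' ∈ s, f a j' ≤ f a j)} := by
      ext a
      simp only [Set.mem_preimage, Set.mem_singleton_iff, Set.mem_iInter, Set.mem_ofPred_eq,
        ← mem_argmaxOn]
      exact ⟨fun h j => by rw [h], fun h => Finset.ext fun j => (h j).symm⟩
    rw [this]
    refine MeasurableSet.iInter fun j => ?_
    have h : MeasurableSet {a | ∀ j' ∈ s, f a j' ≤ f a j} := by
      have : {a | ∀ j' ∈ s, f a j' ≤ f a j} = ⋂ j' ∈ s, {a | f a j' ≤ f a j} := by ext; simp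
      rw [this]
      exact Finset.measurableSet_biInter _ fun j' _ => measurableSet_le (hf j') (hf j)
    exact (MeasurableSet.const _).iff ((MeasurableSet.const _).inter h)
  exact (measurable_from_top (f := tie)).comp this

lemma exists_level_iff {N t θ c : ℝ} :
    (∃ l, c < l ∧ (0 < l ∧ l ≤ t ∧ N - (t - l) * θ = l)) ↔
      (θ = 1 ∧ N = t ∧ c < t ∧ 0 < t) ∨
        (θ ≠ 1 ∧ c < (N - t * θ) / (1 - θ) ∧ 0 < (N - t * θ) / (1 - θ) ∧
          (N - t * θ) / (1 - θ) ≤ t) := by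
  by_cases hθ : θ = 1
  · subst hθ
    constructor
    · rintro ⟨l, h1, h2, h3, h4⟩
      exact Or.inl ⟨rfl, by linarith, by linarith, by linarith⟩
    · rintro (⟨-, h1, h2, h3⟩ | ⟨h, -⟩)
      · exact ⟨t, h2, h3, le_rfl, by linarith⟩
      · exact absurd rfl h
  · have h0 : 1 - θ ≠ 0 := fun h => hθ (by linarith)
    have key : ∀ l, N - (t - l) * θ = l ↔ l = (N - t * θ) / (1 - θ) := fun l => by
      rw [eq_div_iff h0]
      constructor <;> intro h <;> linarith
    constructor
    · rintro ⟨l, h1, h2, h3, h4⟩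
      rw [key] at h4
      subst h4
      exact Or.inr ⟨hθ, h1, h2, h3⟩
    · rintro (⟨h, -⟩ | ⟨-, h1, h2, h3⟩)
      · exact absurd h hθ
      · exact ⟨_, h1, h2, h3, (key _).2 rfl⟩

lemma lt_nextKnot_iff (X : Matrix (Fin n) (Fin p) ℝ) {m : ℕ} (S : State p m) {c : ℝ}
    (hc : 0 ≤ c) :
    c < nextKnot X S ↔ ∃ j ∈ inactive S.vars, ∃ l, c < l ∧ (0 < l ∧ l ≤ S.knot ∧
      S.resid j - (S.knot - l) * theta X S.vars j = l) := by
  have hb : BddAbove {l : ℝ | 0 < l ∧ l ≤ S.knot ∧ ∃ j ∈ inactive S.vars, residAt X S l j = l} :=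
    ⟨S.knot, fun l hl => hl.2.1⟩
  constructor
  · intro h
    have hne : {l : ℝ | 0 < l ∧ l ≤ S.knot ∧
        ∃ j ∈ inactive S.vars, residAt X S l j = l}.Nonempty := by
      by_contra h0
      rw [Set.not_nonempty_iff_eq_empty] at h0
      rw [nextKnot, h0, Real.sSup_empty] at h
      linarith
    obtain ⟨l, ⟨h1, h2, j, hj, h3⟩, h4⟩ := exists_lt_of_lt_csSup hne h
    exact ⟨j, hj, l, h4, h1, h2, h3⟩
  · rintro ⟨j, hj, l, h4, h1, h2, h3⟩
    exact h4.trans_le (le_csSup hb ⟨h1, h2, j, hj, h3⟩)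

lemma nextKnot_nonneg (X : Matrix (Fin n) (Fin p) ℝ) {m : ℕ} (S : State p m) :
    0 ≤ nextKnot X S := Real.sSup_nonneg fun _ h => h.1.le

lemma measurable_nextKnot_mk (X : Matrix (Fin n) (Fin p) ℝ) {m : ℕ} (i : Fin m → SignedVar p) :
    Measurable fun q : ℝ × (SignedVar p → ℝ) => nextKnot X ⟨i, q.1, q.2⟩ := by
  refine measurable_of_Ioi fun c => ?_
  rcases lt_or_ge c 0 with hc | hc
  · convert MeasurableSet.univ
    exact Set.eq_univ_of_forall fun q => hc.trans_le (nextKnot_nonneg X _)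
  · have : (fun q : ℝ × (SignedVar p → ℝ) => nextKnot X ⟨i, q.1, q.2⟩) ⁻¹' Set.Ioi c =
        ⋃ j ∈ inactive i, {q | (theta X i j = 1 ∧ q.2 j = q.1 ∧ c < q.1 ∧ 0 < q.1) ∨
          (theta X i j ≠ 1 ∧ c < (q.2 j - q.1 * theta X i j) / (1 - theta X i j) ∧
            0 < (q.2 j - q.1 * theta X i j) / (1 - theta X i j) ∧
            (q.2 j - q.1 * theta X i j) / (1 - theta X i j) ≤ q.1)} := by
      ext q
      simp only [Set.mem_preimage, Set.mem_Ioi, lt_nextKnot_iff X _ hc, Set.mem_iUnion,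
        Set.mem_ofPred_eq, exists_level_iff, exists_prop]
    rw [this]
    refine Finset.measurableSet_biUnion _ fun j _ => ?_
    have h2 : Measurable fun q : ℝ × (SignedVar p → ℝ) => q.2 j := by fun_prop
    have h3 : Measurable fun q : ℝ × (SignedVar p → ℝ) =>
        (q.2 j - q.1 * theta X i j) / (1 - theta X i j) := by fun_prop
    exact ((MeasurableSet.const _).inter ((measurableSet_eq_fun h2 measurable_fst).inter
      ((measurableSet_lt measurable_const measurable_fst).inter
        (measurableSet_lt measurable_const measurable_fst)))).union
      ((MeasurableSet.const _).inter ((measurableSet_lt measurable_const h3).inter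
        ((measurableSet_lt measurable_const h3).inter (measurableSet_le h3 measurable_fst))))

lemma measurable_signedCorr (X : Matrix (Fin n) (Fin p) ℝ) (j : SignedVar p) :
    Measurable fun y => signedCorr X y j := by
  simp_rw [← inner_signedCol]
  fun_prop

lemma measurable_tie_argmaxOn_inactive {α : Type*} [MeasurableSpace α]
    (tie : Finset (SignedVar p) → SignedVar p) {m : ℕ} {V : α → Fin m → SignedVar p}
    {f : α → SignedVar p → ℝ} (hV : Measurable V) (hf : ∀ j, Measurable fun a => f a j) :
    Measurable fun a => tie (argmaxOn (inactive (V a)) (f a)) := by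
  have h : Measurable fun q : (Fin m → SignedVar p) × (SignedVar p → ℝ) =>
      tie (argmaxOn (inactive q.1) q.2) := by
    refine measurable_from_prod_countable_right ?_
    intro i
    exact measurable_argmaxOn (f := fun g : SignedVar p → ℝ => g) (inactive i)
      (fun j => measurable_pi_apply j) tie
  have hVf : Measurable fun a => (V a, f a) := hV.prodMk (measurable_pi_lambda f hf)
  have hcomp := h.comp hVf
  exact hcomp

lemma measurable_step {α : Type*} [MeasurableSpace α] (tie : Finset (SignedVar p) → SignedVar p)
    (X : Matrix (Fin n) (Fin p) ℝ) {m : ℕ} {S : α → State p m}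
    (h1 : Measurable fun a => (S a).vars) (h2 : Measurable fun a => (S a).knot)
    (h3 : ∀ j, Measurable fun a => (S a).resid j) :
    Measurable (fun a => (step tie X (S a)).vars) ∧
      Measurable (fun a => (step tie X (S a)).knot) ∧
      ∀ j, Measurable fun a => (step tie X (S a)).resid j := by
  have hq : Measurable fun a => ((S a).vars, ((S a).knot, (S a).resid)) :=
    h1.prodMk (h2.prodMk (measurable_pi_lambda _ h3))
  have hknot : Measurable fun a => nextKnot X (S a) := by
    have h : Measurable fun q : (Fin m → SignedVar p) × (ℝ × (SignedVar p → ℝ)) =>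
        nextKnot X ⟨q.1, q.2.1, q.2.2⟩ :=
      measurable_from_prod_countable_right fun i => measurable_nextKnot_mk X i
    exact h.comp hq
  have htheta : ∀ j, Measurable fun a => theta X (S a).vars j := fun j =>
    (Measurable.of_discrete (f := fun i : Fin m → SignedVar p => theta X i j)).comp h1
  have hresid : ∀ j, Measurable fun a => residAt X (S a) (nextKnot X (S a)) j := fun j =>
    (h3 j).sub ((h2.sub hknot).mul (htheta j))
  refine ⟨measurable_pi_lambda _ fun b => ?_, hknot, hresid⟩
  have htie : Measurable fun a =>
      tie (argmaxOn (inactive (S a).vars) (residAt X (S a) (nextKnot X (S a)))) :=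
    measurable_tie_argmaxOn_inactive tie h1 hresid
  refine Fin.lastCases ?_ (fun b => ?_) b
  · simpa [step] using htie
  · simpa [step] using measurable_pi_iff.1 h1 b

lemma measurable_state (tie : Finset (SignedVar p) → SignedVar p) (X : Matrix (Fin n) (Fin p) ℝ)
    (k : ℕ) :
    Measurable (fun y => (state tie X y k).vars) ∧ Measurable (fun y => (state tie X y k).knot) ∧
      ∀ j, Measurable fun y => (state tie X y k).resid j := by
  induction k with
  | zero =>
    refine ⟨measurable_pi_lambda _ fun _ => ?_, ?_, fun j => measurable_signedCorr X j⟩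
    · exact measurable_argmaxOn _ (fun j => measurable_signedCorr X j) tie
    · exact Measurable.iSup fun j => measurable_signedCorr X j
  | succ k ih => exact measurable_step tie X ih.1 ih.2.1 ih.2.2

lemma measurable_knot (tie : Finset (SignedVar p) → SignedVar p) (X : Matrix (Fin n) (Fin p) ℝ)
    (k : ℕ) : Measurable fun y => knot tie X y k := (measurable_state tie X k).2.1

lemma measurable_knots (tie : Finset (SignedVar p) → SignedVar p) (X : Matrix (Fin n) (Fin p) ℝ)
    (K : ℕ) : Measurable (knots tie X K) := measurable_pi_lambda _ fun k => measurable_knot tie X k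

lemma measurable_vars (tie : Finset (SignedVar p) → SignedVar p) (X : Matrix (Fin n) (Fin p) ℝ)
    (K : ℕ) : Measurable (vars tie X K) :=
  measurable_pi_lambda _ fun k => measurable_pi_iff.1 (measurable_state tie X k).1 _

/-! ### Gaussian linear forms -/

section Gaussian

variable {Ω : Type*} [MeasurableSpace Ω] {P : Measure Ω}
  {ι : Type*} [Fintype ι] [DecidableEq ι] {μ : EuclideanSpace ℝ ι} {σ : ℝ}
  {Y : Ω → EuclideanSpace ℝ ι}

lemma covariance_inner_inner_of_hasLaw
    (hY : HasLaw Y (multivariateGaussian μ (σ ^ 2 • 1)) P) (u v : EuclideanSpace ℝ ι) :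
    cov[fun ω => ⟪u, Y ω⟫_ℝ, fun ω => ⟪v, Y ω⟫_ℝ; P] = σ ^ 2 * ⟪u, v⟫_ℝ := by
  have hS : (σ ^ 2 • (1 : Matrix ι ι ℝ)).PosSemidef := Matrix.PosSemidef.one.smul (sq_nonneg σ)
  have h1 := covarianceBilin_multivariateGaussian (μ := μ) hS u v
  rw [covarianceBilin_apply_eq_cov IsGaussian.memLp_two_id, ← hY.map_eq,
    covariance_map (by fun_prop) (by fun_prop) hY.aemeasurable] at h1
  simp only [Function.comp_def] at h1
  rw [h1]
  simp [Matrix.smul_mulVec, PiLp.inner_apply, dotProduct, Finset.mul_sum, mul_comm,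
    mul_left_comm]

lemma map_inner_of_hasLaw
    (hY : HasLaw Y (multivariateGaussian μ (σ ^ 2 • 1)) P) (u : EuclideanSpace ℝ ι) :
    P.map (fun ω => ⟪u, Y ω⟫_ℝ) = gaussianReal ⟪u, μ⟫_ℝ (σ ^ 2 * ‖u‖ ^ 2).toNNReal := by
  have hG : HasGaussianLaw Y P := hY.hasGaussianLaw
  have hu : HasGaussianLaw (fun ω => ⟪u, Y ω⟫_ℝ) P := hG.map (innerSL ℝ u)
  rw [hu.map_eq_gaussianReal, ← covariance_self hu.aemeasurable,
    covariance_inner_inner_of_hasLaw hY, real_inner_self_eq_norm_sq]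
  congr 1
  rw [integral_inner hG.integrable]
  rw [hY.integral_eq]
  simp

lemma ae_inner_ne_of_hasLaw (hσ : 0 < σ)
    (hY : HasLaw Y (multivariateGaussian μ (σ ^ 2 • 1)) P) {u v : EuclideanSpace ℝ ι}
    (huv : u ≠ v) : ∀ᵐ ω ∂P, ⟪u, Y ω⟫_ℝ ≠ ⟪v, Y ω⟫_ℝ := by
  have hw : u - v ≠ 0 := sub_ne_zero.2 huv
  have hm : AEMeasurable (fun ω => ⟪u - v, Y ω⟫_ℝ) P :=
    (measurable_const.inner measurable_id).comp_aemeasurable hY.aemeasurable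
  have hv : (σ ^ 2 * ‖u - v‖ ^ 2).toNNReal ≠ 0 := by
    rw [Ne, Real.toNNReal_eq_zero, not_le]
    have := norm_pos_iff.2 hw
    positivity
  have h0 : ∀ᵐ x ∂P.map (fun ω => ⟪u - v, Y ω⟫_ℝ), x ≠ 0 := by
    rw [map_inner_of_hasLaw hY]
    have := nullSingletonClass_gaussianReal (μ := ⟪u - v, μ⟫_ℝ) hv
    exact Measure.ae_ne _ _
  filter_upwards [ae_of_ae_map hm h0] with ω hω h
  rw [inner_sub_left, h, sub_self] at hω
  exact hω rfl

/-- Two families of linear forms of an isotropic Gaussian vector that are orthogonal to each other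
are independent. -/
lemma indepFun_inner_of_hasLaw {κ κ' : Type*} [Fintype κ] [Fintype κ']
    (hY : HasLaw Y (multivariateGaussian μ (σ ^ 2 • 1)) P) {v : κ → EuclideanSpace ℝ ι}
    {w : κ' → EuclideanSpace ℝ ι} (hvw : ∀ a b, ⟪v a, w b⟫_ℝ = 0) :
    IndepFun (fun ω a => ⟪v a, Y ω⟫_ℝ) (fun ω b => ⟪w b, Y ω⟫_ℝ) P := by
  have hG : HasGaussianLaw Y P := hY.hasGaussianLaw
  refine HasGaussianLaw.indepFun_of_covariance_eval
    (X := fun a ω => ⟪v a, Y ω⟫_ℝ) (Y := fun b ω => ⟪w b, Y ω⟫_ℝ)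
    (hG.map ((ContinuousLinearMap.pi fun a => innerSL ℝ (v a)).prod
      (ContinuousLinearMap.pi fun b => innerSL ℝ (w b)))) fun a b => ?_
  rw [covariance_inner_inner_of_hasLaw hY, hvw, mul_zero]

/-- Orthogonal linear forms of an isotropic Gaussian vector are independent Gaussian variables. -/
lemma map_inner_pi_of_hasLaw [IsProbabilityMeasure P] {κ : Type*} [Fintype κ]
    (hY : HasLaw Y (multivariateGaussian μ (σ ^ 2 • 1)) P) {v : κ → EuclideanSpace ℝ ι}
    (hv : ∀ a b, a ≠ b → ⟪v a, v b⟫_ℝ = 0) :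
    P.map (fun ω a => ⟪v a, Y ω⟫_ℝ) =
      Measure.pi fun a => gaussianReal ⟪v a, μ⟫_ℝ (σ ^ 2 * ‖v a‖ ^ 2).toNNReal := by
  have hG : HasGaussianLaw Y P := hY.hasGaussianLaw
  have hind : iIndepFun (fun a ω => ⟪v a, Y ω⟫_ℝ) P :=
    HasGaussianLaw.iIndepFun_of_covariance_eq_zero
      (hG.map (ContinuousLinearMap.pi fun a => innerSL ℝ (v a))) fun a b hab => by
        rw [covariance_inner_inner_of_hasLaw hY, hv a b hab, mul_zero]
  rw [(iIndepFun_iff_map_fun_eq_pi_map (f := fun a ω => ⟪v a, Y ω⟫_ℝ) fun a =>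
    (measurable_const.inner measurable_id).comp_aemeasurable hY.aemeasurable).1 hind]
  simp_rw [map_inner_of_hasLaw hY]

end Gaussian

/-! ### Conditioning a product of densities -/

lemma pi_withDensity_ofReal {ι : Type*} [Fintype ι] {f : ι → ℝ → ℝ}
    (hf : ∀ a, Integrable (f a)) (h0 : ∀ a x, 0 ≤ f a x) :
    Measure.pi (fun a => (volume : Measure ℝ).withDensity fun x => ENNReal.ofReal (f a x)) =
      (volume : Measure (ι → ℝ)).withDensity fun x => ENNReal.ofReal (∏ a, f a (x a)) := by
  have : ∀ a, IsFiniteMeasure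
      ((volume : Measure ℝ).withDensity fun x => ENNReal.ofReal (f a x)) := fun a =>
    isFiniteMeasure_withDensity_ofReal (hf a).2
  refine Measure.pi_eq fun s hs => ?_
  rw [withDensity_apply _ (MeasurableSet.univ_pi hs), volume_pi, Measure.restrict_pi_pi,
    ← ofReal_integral_eq_lintegral_ofReal
      (Integrable.fintype_prod fun a => (hf a).integrableOn)
      (Filter.Eventually.of_forall fun x => Finset.prod_nonneg fun a _ => h0 a _),
    integral_fintype_prod_eq_prod,
    ENNReal.ofReal_prod_of_nonneg fun a _ => integral_nonneg (h0 a)]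
  refine Finset.prod_congr rfl fun a _ => ?_
  rw [withDensity_apply _ (hs a), ofReal_integral_eq_lintegral_ofReal (hf a).integrableOn
    (Filter.Eventually.of_forall (h0 a))]

lemma cond_withDensity_ofReal {E : Type*} [MeasurableSpace E] {μ : Measure E} {f : E → ℝ}
    (hfm : Measurable f) (hf : Integrable f μ) (h0 : ∀ x, 0 ≤ f x) {S : Set E}
    (hS : MeasurableSet S)
    (hpos : (μ.withDensity fun x => ENNReal.ofReal (f x)) S ≠ 0) :
    0 < ∫ x, S.indicator f x ∂μ ∧
      ProbabilityTheory.cond (μ.withDensity fun x => ENNReal.ofReal (f x)) S =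
        μ.withDensity fun x =>
          ENNReal.ofReal ((∫ x, S.indicator f x ∂μ)⁻¹ * S.indicator f x) := by
  have hint : (μ.withDensity fun x => ENNReal.ofReal (f x)) S =
      ENNReal.ofReal (∫ x, S.indicator f x ∂μ) := by
    rw [integral_indicator hS, withDensity_apply _ hS,
      ofReal_integral_eq_lintegral_ofReal hf.integrableOn (Filter.Eventually.of_forall h0)]
  have hQ : 0 < ∫ x, S.indicator f x ∂μ := by
    rw [hint] at hpos
    exact ENNReal.ofReal_pos.1 (pos_iff_ne_zero.2 hpos)
  refine ⟨hQ, ?_⟩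
  rw [ProbabilityTheory.cond, hint, restrict_withDensity hS, ← withDensity_indicator hS,
    ← ENNReal.ofReal_inv_of_pos hQ, ← withDensity_smul _ (hfm.ennreal_ofReal.indicator hS)]
  congr 1
  ext x
  rw [Pi.smul_apply, smul_eq_mul, ENNReal.ofReal_mul (inv_pos.2 hQ).le]
  by_cases hx : x ∈ S <;> simp [hx]

/-! ### Conditional law on a selection event -/

section CondDistrib

variable {Ω : Type*} [MeasurableSpace Ω] {P : Measure Ω} [IsProbabilityMeasure P]
  {ι : Type*} [MeasurableSpace ι] [MeasurableSingletonClass ι]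
  {E : Type*} [MeasurableSpace E] [StandardBorelSpace E] [Nonempty E]

/-- The kernel that sends `(v, l)` to `μ` conditioned on `S l`. -/
def selectionKernel (ι : Type*) [MeasurableSpace ι] (μ : Measure E) [IsProbabilityMeasure μ]
    (S : ℝ → Set E) (hS : MeasurableSet {q : ℝ × E | q.2 ∈ S q.1}) : Kernel (ι × ℝ) E where
  toFun q := ProbabilityTheory.cond μ (S q.2)
  measurable' := by
    have hSl : ∀ l, MeasurableSet (S l) := fun l => hS.preimage (measurable_prodMk_left (x := l))
    refine Measure.measurable_of_measurable_coe _ fun A hA => ?_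
    have h1 : Measurable fun l : ℝ => μ (S l) := measurable_measure_prodMk_left hS
    have h2 : Measurable fun l : ℝ => μ (S l ∩ A) :=
      measurable_measure_prodMk_left (s := {q : ℝ × E | q.2 ∈ S q.1} ∩ (Prod.snd ⁻¹' A))
        (hS.inter (measurable_snd hA))
    simp_rw [cond_apply (hSl _)]
    exact (h1.inv.mul h2).comp measurable_snd

/-- If on the selection event `{V = i}` the pair `(G, L)` agrees with an independent pair `(g, h)`
and the event itself is `{g ∈ S h}`, then given `V = i` and `L = l` the law of `G` is the law of
`g` conditioned on `S l`. -/
lemma condDistrib_eq_cond_of_selection {V : Ω → ι} {L : Ω → ℝ} {G g : Ω → E} {h : Ω → ℝ}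
    (hV : AEMeasurable V P) (hL : AEMeasurable L P) (hG : AEMeasurable G P)
    (hg : AEMeasurable g P) (hh : AEMeasurable h P) (hind : IndepFun g h P)
    {S : ℝ → Set E} (hS : MeasurableSet {q : ℝ × E | q.2 ∈ S q.1})
    (hpos : ∀ l, P.map g (S l) ≠ 0) {i : ι}
    (hsel : ∀ᵐ ω ∂P, V ω = i ↔ g ω ∈ S (h ω))
    (heq : ∀ᵐ ω ∂P, V ω = i → G ω = g ω ∧ L ω = h ω) :
    ∀ᵐ ω ∂P, V ω = i → condDistrib G (fun ω => (V ω, L ω)) P (V ω, L ω) =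
      ProbabilityTheory.cond (P.map g) (S (L ω)) := by
  classical
  have : IsProbabilityMeasure (P.map g) := Measure.isProbabilityMeasure_map hg
  have : IsProbabilityMeasure (P.map h) := Measure.isProbabilityMeasure_map hh
  have hSl : ∀ l, MeasurableSet (S l) := fun l => hS.preimage (measurable_prodMk_left (x := l))
  have hVL : AEMeasurable (fun ω => (V ω, L ω)) P := hV.prodMk hL
  set D := condDistrib G (fun ω => (V ω, L ω)) P with hD
  set κ := selectionKernel ι (P.map g) S hS with hκ
  have hκM : IsMarkovKernel κ := ⟨fun q => cond_isProbabilityMeasure (hpos q.2)⟩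
  have hT : MeasurableSet (Prod.fst ⁻¹' {i} : Set (ι × ℝ)) :=
    measurable_fst (measurableSet_singleton i)
  set η := Kernel.piecewise hT κ D with hη
  have : IsMarkovKernel η := inferInstance
  have hjoint : P.map (fun ω => (g ω, h ω)) = (P.map g).prod (P.map h) :=
    (indepFun_iff_map_prod_eq_prod_map_map hg hh).1 hind
  have hDeq : P.map (fun ω => ((V ω, L ω), G ω)) = P.map (fun ω => (V ω, L ω)) ⊗ₘ D :=
    (compProd_map_condDistrib hG).symm
  -- on the selection event both sides are computed from the product law of `(g, h)`
  have hkey : ∀ B : Set ℝ, ∀ A : Set E, MeasurableSet B → MeasurableSet A →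
      P {ω | V ω = i ∧ L ω ∈ B ∧ G ω ∈ A} =
        ∫⁻ ω in {ω | V ω = i ∧ L ω ∈ B}, ProbabilityTheory.cond (P.map g) (S (L ω)) A ∂P := by
    intro B A hB hA
    have e1 : P {ω | V ω = i ∧ L ω ∈ B ∧ G ω ∈ A} =
        P ((fun ω => (g ω, h ω)) ⁻¹' {q | q.1 ∈ S q.2 ∩ A ∧ q.2 ∈ B}) := by
      refine measure_congr ?_
      filter_upwards [hsel, heq] with ω h1 h2
      refine propext ⟨fun ⟨a, b, c⟩ => ?_, fun ⟨⟨a, b⟩, c⟩ => ?_⟩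
      · obtain ⟨h3, h4⟩ := h2 a
        exact ⟨⟨h1.1 a, show g ω ∈ A from h3 ▸ c⟩, show h ω ∈ B from h4 ▸ b⟩
      · obtain ⟨h3, h4⟩ := h2 (h1.2 a)
        exact ⟨h1.2 a, show L ω ∈ B from h4.symm ▸ c, show G ω ∈ A from h3.symm ▸ b⟩
    have hSm : MeasurableSet {q : E × ℝ | q.1 ∈ S q.2} := hS.preimage measurable_swap
    have hm : MeasurableSet {q : E × ℝ | q.1 ∈ S q.2 ∩ A ∧ q.2 ∈ B} :=
      (hSm.inter (measurable_fst hA)).inter (measurable_snd hB)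
    have e2 : ∫⁻ ω in {ω | V ω = i ∧ L ω ∈ B},
          ProbabilityTheory.cond (P.map g) (S (L ω)) A ∂P =
        ∫⁻ ω, {q : E × ℝ | q.1 ∈ S q.2 ∧ q.2 ∈ B}.indicator
          (fun q => ProbabilityTheory.cond (P.map g) (S q.2) A) (g ω, h ω) ∂P := by
      have hm2 : NullMeasurableSet {ω | V ω = i ∧ L ω ∈ B} P :=
        hVL.nullMeasurable ((measurableSet_singleton i).prod hB)
      rw [← lintegral_indicator₀ hm2]
      refine lintegral_congr_ae ?_
      filter_upwards [hsel, heq] with ω h1 h2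
      by_cases hi : V ω = i
      · obtain ⟨h3, h4⟩ := h2 hi
        have h5 := h1.1 hi
        by_cases hb : h ω ∈ B
        · rw [Set.indicator_of_mem (show ω ∈ {ω | V ω = i ∧ L ω ∈ B} from ⟨hi, h4.symm ▸ hb⟩),
            Set.indicator_of_mem
              (show (g ω, h ω) ∈ {q : E × ℝ | q.1 ∈ S q.2 ∧ q.2 ∈ B} from ⟨h5, hb⟩), h4]
        · rw [Set.indicator_of_notMem (fun hc => hb (h4 ▸ hc.2)),
            Set.indicator_of_notMem (fun hc => hb hc.2)]
      · rw [Set.indicator_of_notMem (fun hc => hi hc.1),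
          Set.indicator_of_notMem (fun hc => hi (h1.2 hc.1))]
    have hcm : Measurable fun q : E × ℝ => ProbabilityTheory.cond (P.map g) (S q.2) A :=
      ((κ.measurable_coe hA).comp (measurable_const.prodMk measurable_id (f := fun _ => i))).comp
        measurable_snd
    have hm3 : MeasurableSet {q : E × ℝ | q.1 ∈ S q.2 ∧ q.2 ∈ B} :=
      hSm.inter (measurable_snd hB)
    rw [e1, e2, ← Measure.map_apply_of_aemeasurable (hg.prodMk hh) hm,
      ← lintegral_map' (f := {q : E × ℝ | q.1 ∈ S q.2 ∧ q.2 ∈ B}.indicator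
          (fun q => ProbabilityTheory.cond (P.map g) (S q.2) A)) (hcm.indicator hm3).aemeasurable
        (hg.prodMk hh), hjoint, Measure.prod_apply_symm hm,
      lintegral_prod_symm _ (hcm.indicator hm3).aemeasurable]
    refine lintegral_congr fun l => ?_
    by_cases hl : l ∈ B
    · have s1 : (fun x => (x, l)) ⁻¹' {q : E × ℝ | q.1 ∈ S q.2 ∩ A ∧ q.2 ∈ B} = S l ∩ A := by
        ext x; simp [hl]
      have s2 : ∀ x, {q : E × ℝ | q.1 ∈ S q.2 ∧ q.2 ∈ B}.indicator
          (fun q => ProbabilityTheory.cond (P.map g) (S q.2) A) (x, l) =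
          (S l).indicator (fun _ => ProbabilityTheory.cond (P.map g) (S l) A) x := by
        intro x; by_cases hx : x ∈ S l <;> simp [hx, hl]
      simp_rw [s1, s2]
      rw [lintegral_indicator_const (hSl l), cond_apply (hSl l), mul_comm, ← mul_assoc,
        ENNReal.mul_inv_cancel (hpos l) (measure_ne_top _ _), one_mul]
    · simp [hl]
  have hmain : P.map (fun ω => ((V ω, L ω), G ω)) = P.map (fun ω => (V ω, L ω)) ⊗ₘ η := by
    have : IsProbabilityMeasure (P.map (fun ω => (V ω, L ω))) :=
      Measure.isProbabilityMeasure_map hVL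
    have : IsProbabilityMeasure (P.map (fun ω => ((V ω, L ω), G ω))) :=
      Measure.isProbabilityMeasure_map (hVL.prodMk hG)
    refine Measure.ext_prod fun {s t} hs ht => ?_
    set T : Set (ι × ℝ) := Prod.fst ⁻¹' {i} with hTdef
    have hsplit : s ×ˢ t = ((s ∩ T) ×ˢ t) ∪ ((s \ T) ×ˢ t) := by
      rw [← Set.union_prod, Set.inter_union_sdiff]
    have hdisj : Disjoint ((s ∩ T) ×ˢ t) ((s \ T) ×ˢ t) :=
      Set.Disjoint.set_prod_left Set.disjoint_sdiff_inter.symm _ _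
    rw [hsplit, measure_union hdisj ((hs.diff hT).prod ht),
      measure_union hdisj ((hs.diff hT).prod ht)]
    congr 1
    · set B : Set ℝ := Prod.mk i ⁻¹' s with hB
      have hBm : MeasurableSet B := measurable_prodMk_left hs
      have hset : ∀ ω, (V ω, L ω) ∈ s ∩ T ↔ V ω = i ∧ L ω ∈ B := fun ω =>
        ⟨fun h => ⟨h.2, by have := h.1; rw [show V ω = i from h.2] at this; exact this⟩,
          fun h => ⟨by rw [h.1]; exact h.2, h.1⟩⟩
      rw [Measure.compProd_apply_prod (hs.inter hT) ht,
        Measure.map_apply_of_aemeasurable (hVL.prodMk hG) ((hs.inter hT).prod ht),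
        setLIntegral_congr_fun (g := fun q => κ q t) (hs.inter hT) (fun q hq => by
          rw [hη, Kernel.piecewise_apply, if_pos hq.2]),
        ← lintegral_indicator (hs.inter hT),
        lintegral_map' ((κ.measurable_coe ht).indicator (hs.inter hT)).aemeasurable hVL]
      have hm2 : NullMeasurableSet {ω | V ω = i ∧ L ω ∈ B} P :=
        hVL.nullMeasurable ((measurableSet_singleton i).prod hBm)
      have h1 := hkey B t hBm ht
      rw [← lintegral_indicator₀ hm2] at h1
      convert h1 using 2
      · ext ω
        simp only [Set.mem_preimage, Set.mem_prod, hset, Set.mem_ofPred_eq, and_assoc]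
      · ext ω
        by_cases hω : V ω = i ∧ L ω ∈ B
        · rw [Set.indicator_of_mem ((hset ω).2 hω), Set.indicator_of_mem (by exact hω)]
          rfl
        · rw [Set.indicator_of_notMem fun h => hω ((hset ω).1 h),
            Set.indicator_of_notMem (by exact hω)]
    · rw [hDeq, Measure.compProd_apply_prod (hs.diff hT) ht,
        Measure.compProd_apply_prod (hs.diff hT) ht]
      refine setLIntegral_congr_fun (hs.diff hT) fun q hq => ?_
      rw [hη, Kernel.piecewise_apply, if_neg hq.2]
  have huniq := condDistrib_ae_eq_of_measure_eq_compProd (fun ω => (V ω, L ω)) hG hmain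
  filter_upwards [ae_of_ae_map hVL huniq] with ω h1 h2
  rw [h1, hη, Kernel.piecewise_apply, if_pos (by simpa using h2)]
  rfl

end CondDistrib

/-! ### The selection event -/

lemma exists_perpCol_ne_zero {X : Matrix (Fin n) (Fin p) ℝ} {m : ℕ} {i : Fin m → SignedVar p}
    (hi : Indep X i) (hm : m < X.rank) : ∃ j, perpCol X i j ≠ 0 := by
  by_contra! h
  simp_rw [perpCol_eq_zero_iff hi] at h
  let e : EuclideanSpace ℝ (Fin n) →ₗ[ℝ] (Fin n → ℝ) :=
    (WithLp.linearEquiv 2 ℝ (Fin n → ℝ)).toLinearMap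
  set W := Submodule.span ℝ (Set.range fun a => signedCol X (i a))
  have hle : Submodule.span ℝ (Set.range X.col) ≤ W.map e := by
    rw [Submodule.span_le]
    rintro _ ⟨j, rfl⟩
    refine ⟨signedCol X (Sum.inl j), h _, ?_⟩
    simp [e, signedCol, sgn, var]
  have h1 := Submodule.finrank_mono hle
  rw [← Matrix.rank_eq_finrank_span_cols] at h1
  have h2 : Module.finrank ℝ (W.map e) ≤ Module.finrank ℝ W :=
    Submodule.finrank_map_le _ _
  have h3 : Module.finrank ℝ W ≤ m := by
    exact (finrank_range_le_card (R := ℝ) (fun a => signedCol X (i a))).trans_eq (by simp)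
  omega

/-- The level at which the first variable outside `i` would enter. -/
def nextLevel (X : Matrix (Fin n) (Fin p) ℝ) {m : ℕ} (i : Fin m → SignedVar p)
    (hi : (inactive i).Nonempty) (y : EuclideanSpace ℝ (Fin n)) : ℝ :=
  (inactive i).sup' hi fun j => ⟪knotVec X i j, y⟫_ℝ

section

variable {tie : Finset (SignedVar p) → SignedVar p} {X : Matrix (Fin n) (Fin p) ℝ}
  {y : EuclideanSpace ℝ (Fin n)} {K : ℕ} {i : ℕ → SignedVar p}

lemma ThetaLtOne.pathSpec (hθ : ThetaLtOne X i K)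
    (htie : ∀ s : Finset (SignedVar p), s.Nonempty → tie s ∈ s)
    (hy : Unfitted X K y) (hi : pre (path tie X y) K = pre i K) {k : ℕ} (hk : k ≤ K) :
    PathSpec tie X y k :=
  LAR.pathSpec htie hy hk ((hθ.congr hi.symm).mono hk)

lemma knot_eq_of_pre_path_eq (hθ : ThetaLtOne X i K)
    (htie : ∀ s : Finset (SignedVar p), s.Nonempty → tie s ∈ s)
    (hy : Unfitted X K y) (hi : pre (path tie X y) K = pre i K) {k : ℕ} (hk : k < K) :
    knot tie X y k = ⟪knotVec X (pre i k) (i k), y⟫_ℝ := by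
  rw [(hθ.pathSpec htie hy hi hk.le).knot_eq ((hθ.congr hi.symm) k hk.le),
    pre_congr_of_le hk.le hi, show path tie X y k = i k from congrFun hi ⟨k, hk⟩]

lemma knot_eq_nextLevel (hθ : ThetaLtOne X i K)
    (htie : ∀ s : Finset (SignedVar p), s.Nonempty → tie s ∈ s)
    (hy : Unfitted X K y) (hi : pre (path tie X y) K = pre i K)
    (hne : (inactive (pre i K)).Nonempty) :
    knot tie X y K = nextLevel X (pre i K) hne y := by
  have hs := hθ.pathSpec htie hy hi le_rfl
  have hθ' := (hθ.congr hi.symm) K le_rfl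
  have h1 := hs.knot_eq hθ'
  have h2 := hs.mem_inactive
  have h3 := fun j => hs.inner_knotVec_le hθ' (j := j)
  rw [hi] at h1 h2 h3
  refine le_antisymm ?_ (Finset.sup'_le _ _ fun j hj => h3 j hj)
  rw [h1]
  exact Finset.le_sup' (fun j => ⟪knotVec X (pre i K) j, y⟫_ℝ) h2

lemma knots_mem_orderedAbove (hθ : ThetaLtOne X i K)
    (htie : ∀ s : Finset (SignedVar p), s.Nonempty → tie s ∈ s)
    (hy : Unfitted X K y) (hi : pre (path tie X y) K = pre i K) :
    knots tie X K y ∈ orderedAbove K (knot tie X y K) := by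
  have h : ∀ a b, a ≤ b → b ≤ K → knot tie X y b ≤ knot tie X y a := by
    intro a b hab
    induction b, hab using Nat.le_induction with
    | base => exact fun _ => le_rfl
    | succ b hab ih =>
      intro hb
      exact ((hθ.pathSpec htie hy hi (b.le_succ.trans hb)).knot_succ_le
        (hθ.pathSpec htie hy hi hb) ((hθ.congr hi.symm).mono hb)).trans (ih (b.le_succ.trans hb))
  exact ⟨fun a b hab => h a b hab b.2.le, fun k => h k K k.2.le le_rfl⟩

/-- The levels `(⟪v₁, y⟫, …, ⟪v_K, y⟫)` at which the variables of `i` enter when the path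
selects `i`. -/
def levels (X : Matrix (Fin n) (Fin p) ℝ) (i : ℕ → SignedVar p) (K : ℕ)
    (y : EuclideanSpace ℝ (Fin n)) : Fin K → ℝ :=
  fun k => ⟪knotVec X (pre i k) (i k), y⟫_ℝ

/-- Away from ties, the levels of `i` being ordered is sufficient for the path to select `i`. -/
lemma pre_path_eq_of_levels_mem (htie : ∀ s : Finset (SignedVar p), s.Nonempty → tie s ∈ s)
    (hy : Unfitted X K y) (hi : Indep X (pre i K)) (hθ : ThetaLtOne X i K)
    (hne : (inactive (pre i K)).Nonempty)
    (hmem : levels X i K y ∈ orderedAbove K (nextLevel X (pre i K) hne y))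
    (h1 : ∀ a b : Fin K, a ≠ b → levels X i K y a ≠ levels X i K y b)
    (h2 : ∀ a : Fin K, ∀ j ∈ inactive (pre i K),
      levels X i K y a ≠ ⟪knotVec X (pre i K) j, y⟫_ℝ) :
    pre (path tie X y) K = pre i K := by
  classical
  obtain ⟨hord, habove⟩ : Antitone (levels X i K y) ∧
      ∀ k, nextLevel X (pre i K) hne y ≤ levels X i K y k := hmem
  set h := nextLevel X (pre i K) hne y with hh
  set g : ℕ → ℝ := fun k => if k < K then ⟪knotVec X (pre i k) (i k), y⟫_ℝ else h with hg
  have hgK : g K = h := by simp [hg]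
  have hglt : ∀ k < K, g k = ⟪knotVec X (pre i k) (i k), y⟫_ℝ := fun k hk => by simp [hg, hk]
  have hle : ∀ j ∈ inactive (pre i K), ⟪knotVec X (pre i K) j, y⟫_ℝ ≤ h := fun j hj =>
    Finset.le_sup' (fun j => ⟪knotVec X (pre i K) j, y⟫_ℝ) hj
  refine pre_path_eq_of_ordered htie hy hi hθ hglt (fun k hk => ?_) ?_ ?_ le_rfl
  · by_cases hk' : k + 1 < K
    · rw [hglt k hk, hglt _ hk']
      have hle' : (⟨k, hk⟩ : Fin K) ≤ ⟨k + 1, hk'⟩ := Fin.mk_le_mk.2 k.le_succ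
      have hne' : (⟨k + 1, hk'⟩ : Fin K) ≠ ⟨k, hk⟩ := Fin.ne_of_val_ne k.succ_ne_self
      have hlt : levels X i K y ⟨k + 1, hk'⟩ < levels X i K y ⟨k, hk⟩ :=
        lt_of_le_of_ne (hord hle') (h1 _ _ hne')
      exact hlt
    · have hK : k + 1 = K := by omega
      obtain ⟨j, hj, hjh⟩ := Finset.exists_mem_eq_sup' hne
        fun j => ⟪knotVec X (pre i K) j, y⟫_ℝ
      rw [hglt k hk, hK, hgK]
      refine lt_of_le_of_ne (habove ⟨k, hk⟩) fun heq => h2 ⟨k, hk⟩ j hj ?_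
      rw [← hjh]
      exact heq.symm
  · obtain ⟨j, hj, hpos⟩ := hy.exists_pos le_rfl hi (hθ K le_rfl)
    rw [hgK]
    exact hpos.trans_le (hle j hj)
  · rw [hgK]
    exact hle

/-! ### Geometry of the knot vectors -/

lemma knotVec_mem_span (i : ℕ → SignedVar p) {a b : ℕ} (hab : a < b) :
    knotVec X (pre i a) (i a) ∈
      Submodule.span ℝ (Set.range fun c => signedCol X (pre i b c)) := by
  have hmem : ∀ c < b, signedCol X (i c) ∈
      Submodule.span ℝ (Set.range fun c => signedCol X (pre i b c)) := fun c hc =>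
    Submodule.subset_span ⟨⟨c, hc⟩, rfl⟩
  exact Submodule.smul_mem _ _ (Submodule.sub_mem _ (hmem a hab)
    (Submodule.sum_mem _ fun c _ => Submodule.smul_mem _ _ (hmem c (c.2.trans hab))))

lemma inner_knotVec_knotVec_of_lt (hi : Indep X (pre i K)) {a b : ℕ} (hab : a < b) (hb : b ≤ K)
    (j : SignedVar p) : ⟪knotVec X (pre i a) (i a), knotVec X (pre i b) j⟫_ℝ = 0 := by
  rw [real_inner_comm]
  exact inner_knotVec_of_mem_span (hi.pre_of_le hb) j (knotVec_mem_span i hab)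

lemma knotVec_ne_zero (hi : Indep X (pre i K)) (hθ : ThetaLtOne X i K) {k : ℕ} (hk : k < K) :
    knotVec X (pre i k) (i k) ≠ 0 := by
  have hp := (indep_pre_succ_iff.1 (hi.pre_of_le hk)).2
  have := hθ k hk.le _ (mem_inactive_of_perpCol_ne_zero (hi.pre_of_le hk.le) hp)
  exact smul_ne_zero (inv_ne_zero (by linarith)) hp

lemma ne_of_inner_eq_zero {u v : EuclideanSpace ℝ (Fin n)} (hu : u ≠ 0) (h : ⟪u, v⟫_ℝ = 0) :
    u ≠ v := by
  rintro rfl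
  exact hu (inner_self_eq_zero.1 h)

lemma knotMean_pre (β : Fin p → ℝ) (k : Fin K) :
    knotMean X β (pre i K) k =
      ⟪knotVec X (pre i k) (i k), WithLp.toLp 2 (X *ᵥ β)⟫_ℝ := by
  rw [inner_knotVec, ← signedMean_eq_signedCorr]
  rfl

lemma knotVar_pre (hi : Indep X (pre i K)) (σ : ℝ) (k : Fin K) :
    knotVar X σ (pre i K) k = (σ ^ 2 * ‖knotVec X (pre i k) (i k)‖ ^ 2).toNNReal := by
  have hik : Indep X (pre i k) := hi.pre_of_le k.2.le
  have hA : ‖perpCol X (pre i k) (i k)‖ ^ 2 = signedGram X (i k) (i k)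
      - regress X (pre i k) (fun a => signedGram X (i k) (pre i k a)) (i k) := by
    have h1 := inner_perpCol X (pre i k) (signedCol X (i k)) (i k)
    simp_rw [signedCorr_signedCol] at h1
    rw [← h1, ← real_inner_self_eq_norm_sq]
    conv_lhs => rw [perpCol, inner_sub_right, ← perpCol]
    rw [inner_perpCol_of_mem_span hik _ (projCol_mem_span X _ _), sub_zero]
  have hρ : knotRho X (pre i K) k ^ 2 = ‖knotVec X (pre i k) (i k)‖ ^ 2 := by
    have : knotRho X (pre i K) k =
        √(‖perpCol X (pre i k) (i k)‖ ^ 2) / (1 - theta X (pre i k) (i k)) := by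
      rw [hA]; rfl
    rw [this, Real.sqrt_sq (norm_nonneg _), knotVec, norm_smul, mul_pow, Real.norm_eq_abs, sq_abs]
    ring
  refine NNReal.eq ?_
  rw [Real.coe_toNNReal _ (by positivity), ← hρ]
  rfl

end

/-! ### The Gaussian law restricted to the ordered region -/

lemma measurableSet_orderedAbove (K : ℕ) :
    MeasurableSet {q : ℝ × (Fin K → ℝ) | q.2 ∈ orderedAbove K q.1} := by
  have : {q : ℝ × (Fin K → ℝ) | q.2 ∈ orderedAbove K q.1} =
      (⋂ a, ⋂ b, {q | a ≤ b → q.2 b ≤ q.2 a}) ∩ ⋂ k, {q | q.1 ≤ q.2 k} := by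
    ext q
    simp [orderedAbove, Antitone]
  rw [this]
  refine MeasurableSet.inter (MeasurableSet.iInter fun a => MeasurableSet.iInter fun b => ?_)
    (MeasurableSet.iInter fun k => measurableSet_le measurable_fst (by fun_prop))
  exact (MeasurableSet.const (a ≤ b)).imp (measurableSet_le (by fun_prop) (by fun_prop))

lemma pi_gaussianReal_orderedAbove_ne_zero {K : ℕ} (m : Fin K → ℝ) {v : Fin K → ℝ≥0}
    (hv : ∀ k, v k ≠ 0) (l : ℝ) :
    Measure.pi (fun k => gaussianReal (m k) (v k)) (orderedAbove K l) ≠ 0 := by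
  have hsub : Set.univ.pi (fun k : Fin K => Set.Ioo (l + (K - k : ℝ)) (l + (K - k : ℝ) + 1)) ⊆
      orderedAbove K l := by
    intro x hx
    have hx' : ∀ k : Fin K, l + (K - k : ℝ) < x k ∧ x k < l + (K - k : ℝ) + 1 := fun k =>
      hx k (Set.mem_univ k)
    refine ⟨fun a b hab => ?_, fun k => ?_⟩
    · rcases hab.eq_or_lt with rfl | hab
      · exact le_rfl
      · have : ((a : ℕ) : ℝ) + 1 ≤ (b : ℕ) := by exact_mod_cast hab
        linarith [(hx' a).1, (hx' b).2]
    · have : ((k : ℕ) : ℝ) ≤ K := by exact_mod_cast k.2.le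
      linarith [(hx' k).1]
  refine ne_of_gt (lt_of_lt_of_le ?_ (measure_mono hsub))
  rw [Measure.pi_pi, pos_iff_ne_zero, Finset.prod_ne_zero_iff]
  intro k _ h0
  have := gaussianReal_absolutelyContinuous' (m k) (hv k) h0
  simp at this

lemma normConst_pos_and_cond_eq {X : Matrix (Fin n) (Fin p) ℝ} {β : Fin p → ℝ} {σ : ℝ} {K : ℕ}
    {i : Fin K → SignedVar p} (hv : ∀ k, knotVar X σ i k ≠ 0) (l : ℝ) :
    0 < normConst X β σ i l ∧
      ProbabilityTheory.cond
          (Measure.pi fun k => gaussianReal (knotMean X β i k) (knotVar X σ i k))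
          (orderedAbove K l) =
        (volume : Measure (Fin K → ℝ)).withDensity fun x =>
          ENNReal.ofReal ((normConst X β σ i l)⁻¹ * weight X β σ i l x) := by
  have hpi : Measure.pi (fun k => gaussianReal (knotMean X β i k) (knotVar X σ i k)) =
      (volume : Measure (Fin K → ℝ)).withDensity fun x =>
        ENNReal.ofReal (∏ k, gaussianPDFReal (knotMean X β i k) (knotVar X σ i k) (x k)) := by
    rw [← pi_withDensity_ofReal (fun k => integrable_gaussianPDFReal _ _)
      fun k x => gaussianPDFReal_nonneg _ _ x]
    congr 1
    ext1 k
    rw [gaussianReal_of_var_ne_zero _ (hv k)]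
    rfl
  have hS : MeasurableSet (orderedAbove K l) :=
    (measurableSet_orderedAbove K).preimage (measurable_prodMk_left (x := l))
  have hne := pi_gaussianReal_orderedAbove_ne_zero (knotMean X β i) hv l
  rw [hpi] at hne ⊢
  exact cond_withDensity_ofReal
    (Finset.measurable_prod _ fun k _ =>
      (measurable_gaussianPDFReal _ _).comp (measurable_pi_apply k))
    (Integrable.fintype_prod fun k => integrable_gaussianPDFReal _ _)
    (fun x => Finset.prod_nonneg fun k _ => gaussianPDFReal_nonneg _ _ _) hS hne

/-! ### The conditional law of the knots -/

section

variable {Ω : Type*} [MeasurableSpace Ω] {P : Measure Ω} {K : ℕ}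
  {X : Matrix (Fin n) (Fin p) ℝ} {β : Fin p → ℝ} {σ : ℝ} {Y : Ω → EuclideanSpace ℝ (Fin n)}

lemma ae_unfitted (hσ : 0 < σ) (hKr : K < X.rank)
    (hY : HasLaw Y (multivariateGaussian (WithLp.toLp 2 (X *ᵥ β)) (σ ^ 2 • 1)) P) :
    ∀ᵐ ω ∂P, Unfitted X K (Y ω) := by
  simp only [Unfitted, ae_all_iff]
  intro m hm i hi
  obtain ⟨j, hj⟩ := exists_perpCol_ne_zero hi (hm.trans_lt hKr)
  filter_upwards [ae_inner_ne_of_hasLaw hσ hY hj] with ω hω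
  exact ⟨j, mem_inactive_of_perpCol_ne_zero hi hj, by simpa using hω⟩

/-- The conditional law of the knots on the event that the path selects `i`. -/
lemma condDistrib_knots_eq_cond [IsProbabilityMeasure P] (hσ : 0 < σ) (hKr : K < X.rank)
    (hY : HasLaw Y (multivariateGaussian (WithLp.toLp 2 (X *ᵥ β)) (σ ^ 2 • 1)) P)
    {tie : Finset (SignedVar p) → SignedVar p}
    (htie : ∀ s : Finset (SignedVar p), s.Nonempty → tie s ∈ s)
    {i : ℕ → SignedVar p} (hi : Indep X (pre i K)) (hθ : ThetaLtOne X i K) :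
    (∀ k, knotVar X σ (pre i K) k ≠ 0) ∧
    ∀ᵐ ω ∂P, vars tie X K (Y ω) = pre i K →
      condDistrib (fun ω' => knots tie X K (Y ω'))
          (fun ω' => (vars tie X K (Y ω'), knot tie X (Y ω') K)) P
          (vars tie X K (Y ω), knot tie X (Y ω) K) =
        ProbabilityTheory.cond
          (Measure.pi fun k =>
            gaussianReal (knotMean X β (pre i K) k) (knotVar X σ (pre i K) k))
          (orderedAbove K (knot tie X (Y ω) K)) := by
  have hYm := hY.aemeasurable
  obtain ⟨j₀, hj₀⟩ := exists_perpCol_ne_zero hi hKr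
  have hne : (inactive (pre i K)).Nonempty := ⟨j₀, mem_inactive_of_perpCol_ne_zero hi hj₀⟩
  have hvar : ∀ k, knotVar X σ (pre i K) k ≠ 0 := fun k => by
    rw [knotVar_pre hi, Ne, Real.toNNReal_eq_zero, not_le]
    have := norm_pos_iff.2 (knotVec_ne_zero hi hθ k.2)
    positivity
  refine ⟨hvar, ?_⟩
  have hlaw : P.map (fun ω => levels X i K (Y ω)) = Measure.pi fun k =>
      gaussianReal (knotMean X β (pre i K) k) (knotVar X σ (pre i K) k) := by
    simp_rw [knotMean_pre, knotVar_pre hi]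
    refine map_inner_pi_of_hasLaw hY fun a b hab => ?_
    rcases lt_or_gt_of_ne hab with h | h
    · exact inner_knotVec_knotVec_of_lt hi h b.2.le _
    · rw [real_inner_comm]
      exact inner_knotVec_knotVec_of_lt hi h a.2.le _
  have hlevels : Measurable (levels X i K) :=
    measurable_pi_lambda _ fun k => measurable_const.inner measurable_id
  have hnext : Measurable (nextLevel X (pre i K) hne) := by
    have := Finset.measurable_sup' hne (f := fun j y => ⟪knotVec X (pre i K) j, y⟫_ℝ)
      fun j _ => measurable_const.inner measurable_id
    convert this using 1
    ext y
    simp [nextLevel, Finset.sup'_apply]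
  have hind : IndepFun (fun ω => levels X i K (Y ω))
      (fun ω => nextLevel X (pre i K) hne (Y ω)) P := by
    have h := indepFun_inner_of_hasLaw hY
      (v := fun k : Fin K => knotVec X (pre i k) (i k)) (w := knotVec X (pre i K))
      fun a j => inner_knotVec_knotVec_of_lt hi a.2 le_rfl j
    have hm : Measurable fun z : SignedVar p → ℝ => (inactive (pre i K)).sup' hne z := by
      have := Finset.measurable_sup' hne (f := fun j (z : SignedVar p → ℝ) => z j)
        fun j _ => measurable_pi_apply j
      convert this using 1
      ext z
      simp [Finset.sup'_apply]
    exact h.comp measurable_id hm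
  have hties : ∀ᵐ ω ∂P, (∀ a b : Fin K, a ≠ b →
      levels X i K (Y ω) a ≠ levels X i K (Y ω) b) ∧ ∀ a : Fin K, ∀ j ∈ inactive (pre i K),
        levels X i K (Y ω) a ≠ ⟪knotVec X (pre i K) j, Y ω⟫_ℝ := by
    refine Filter.Eventually.and ?_ ?_
    · simp only [ae_all_iff]
      intro a b hab
      refine ae_inner_ne_of_hasLaw hσ hY
        (ne_of_inner_eq_zero (knotVec_ne_zero hi hθ a.2) ?_)
      rcases lt_or_gt_of_ne hab with h | h
      · exact inner_knotVec_knotVec_of_lt hi h b.2.le _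
      · rw [real_inner_comm]
        exact inner_knotVec_knotVec_of_lt hi h a.2.le _
    · simp only [ae_all_iff]
      intro a j _
      exact ae_inner_ne_of_hasLaw hσ hY (ne_of_inner_eq_zero (knotVec_ne_zero hi hθ a.2)
        (inner_knotVec_knotVec_of_lt hi a.2 le_rfl j))
  have heq : ∀ y, Unfitted X K y → vars tie X K y = pre i K →
      knots tie X K y = levels X i K y ∧ knot tie X y K = nextLevel X (pre i K) hne y :=
    fun y hy hV => ⟨funext fun k => knot_eq_of_pre_path_eq hθ htie hy hV k.2,
      knot_eq_nextLevel hθ htie hy hV hne⟩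
  rw [← hlaw]
  refine condDistrib_eq_cond_of_selection (V := fun ω => vars tie X K (Y ω))
    (L := fun ω => knot tie X (Y ω) K) (G := fun ω => knots tie X K (Y ω))
    (g := fun ω => levels X i K (Y ω)) (h := fun ω => nextLevel X (pre i K) hne (Y ω))
    ((measurable_vars tie X K).comp_aemeasurable hYm)
    ((measurable_knot tie X K).comp_aemeasurable hYm)
    ((measurable_knots tie X K).comp_aemeasurable hYm) (hlevels.comp_aemeasurable hYm)
    (hnext.comp_aemeasurable hYm) hind (measurableSet_orderedAbove K) (fun l => ?_) ?_ ?_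
  · rw [hlaw]
    exact pi_gaussianReal_orderedAbove_ne_zero _ hvar l
  · filter_upwards [ae_unfitted hσ hKr hY, hties] with ω hy ⟨h1, h2⟩
    constructor
    · intro hV
      obtain ⟨h3, h4⟩ := heq _ hy hV
      rw [← h3, ← h4]
      exact knots_mem_orderedAbove hθ htie hy hV
    · exact fun hmem => pre_path_eq_of_levels_mem htie hy hi hθ hne hmem h1 h2
  · filter_upwards [ae_unfitted hσ hKr hY] with ω hy hV using heq _ hy hV

end

end LAR

end

theorem theorem1 {Ω : Type*} [MeasurableSpace Ω] (P : Measure Ω) [IsProbabilityMeasure P]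
    (n p K : ℕ) (X : Matrix (Fin n) (Fin p) ℝ) (β : Fin p → ℝ) (σ : ℝ) (hσ : 0 < σ)
    (hK : 1 ≤ K) (hKn : K + 3 < n) (hKr : K < X.rank)
    (Y : Ω → EuclideanSpace ℝ (Fin n))
    (hY : HasLaw Y (multivariateGaussian (WithLp.toLp 2 (X *ᵥ β)) (σ ^ 2 • 1)) P)
    (tie : Finset (LAR.SignedVar p) → LAR.SignedVar p)
    (htie : ∀ s : Finset (LAR.SignedVar p), s.Nonempty → tie s ∈ s) :
    AEMeasurable (fun ω => LAR.knots tie X K (Y ω)) P ∧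
    AEMeasurable (fun ω => (LAR.vars tie X K (Y ω), LAR.knot tie X (Y ω) K)) P ∧
    ∀ᵐ ω ∂P, LAR.IrrCheck X (LAR.vars tie X K (Y ω)) →
      0 < LAR.normConst X β σ (LAR.vars tie X K (Y ω)) (LAR.knot tie X (Y ω) K) ∧
      condDistrib (fun ω' => LAR.knots tie X K (Y ω'))
          (fun ω' => (LAR.vars tie X K (Y ω'), LAR.knot tie X (Y ω') K)) P
          (LAR.vars tie X K (Y ω), LAR.knot tie X (Y ω) K)
        = (volume : Measure (Fin K → ℝ)).withDensity (fun x => ENNReal.ofReal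
            ((LAR.normConst X β σ (LAR.vars tie X K (Y ω)) (LAR.knot tie X (Y ω) K))⁻¹
              * LAR.weight X β σ (LAR.vars tie X K (Y ω)) (LAR.knot tie X (Y ω) K) x)) ∧
      condDistrib (fun ω' => LAR.knots tie X K (Y ω'))
          (fun ω' => (LAR.vars tie X K (Y ω'), LAR.knot tie X (Y ω') K)) P
          (LAR.vars tie X K (Y ω), LAR.knot tie X (Y ω) K)
        = ProbabilityTheory.cond
            (Measure.pi (fun k => gaussianReal
              (LAR.knotMean X β (LAR.vars tie X K (Y ω)) k)
              (LAR.knotVar X σ (LAR.vars tie X K (Y ω)) k)))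
            (LAR.orderedAbove K (LAR.knot tie X (Y ω) K)) := by
  have hYm := hY.aemeasurable
  refine ⟨(LAR.measurable_knots tie X K).comp_aemeasurable hYm,
    ((LAR.measurable_vars tie X K).comp_aemeasurable hYm).prodMk
      ((LAR.measurable_knot tie X K).comp_aemeasurable hYm), ?_⟩
  have hp : 0 < p := by
    have := X.rank_le_width
    omega
  have : Nonempty (LAR.SignedVar p) := ⟨Sum.inl ⟨0, hp⟩⟩
  have key : ∀ i : Fin K → LAR.SignedVar p, ∀ᵐ ω ∂P, LAR.vars tie X K (Y ω) = i →
      LAR.IrrCheck X i → (∀ k, LAR.knotVar X σ i k ≠ 0) ∧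
        condDistrib (fun ω' => LAR.knots tie X K (Y ω'))
            (fun ω' => (LAR.vars tie X K (Y ω'), LAR.knot tie X (Y ω') K)) P
            (LAR.vars tie X K (Y ω), LAR.knot tie X (Y ω) K) =
          ProbabilityTheory.cond
            (Measure.pi fun k => gaussianReal (LAR.knotMean X β i k) (LAR.knotVar X σ i k))
            (LAR.orderedAbove K (LAR.knot tie X (Y ω) K)) := by
    intro i
    obtain ⟨i, rfl⟩ := LAR.exists_pre_eq i
    by_cases hirr : LAR.IrrCheck X (LAR.pre i K)
    swap
    · exact ae_of_all _ fun ω _ h => absurd h hirr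
    have hθ := hirr.thetaLtOne
    by_cases hi : LAR.Indep X (LAR.pre i K)
    · obtain ⟨h1, h2⟩ := LAR.condDistrib_knots_eq_cond hσ hKr hY htie hi hθ
      filter_upwards [h2] with ω hω hV _ using ⟨h1, hω hV⟩
    · -- a sequence with dependent columns is almost surely not selected
      filter_upwards [LAR.ae_unfitted hσ hKr hY] with ω hy hV
      have := (hθ.pathSpec htie hy hV le_rfl).indep.pre_of_le K.le_succ
      rw [show LAR.pre (LAR.path tie X (Y ω)) K = LAR.pre i K from hV] at this
      exact absurd this hi
  filter_upwards [ae_all_iff.2 key] with ω hω hirr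
  obtain ⟨hv, hcond⟩ := hω _ rfl hirr
  obtain ⟨hpos, hdens⟩ := LAR.normConst_pos_and_cond_eq (β := β) hv (LAR.knot tie X (Y ω) K)
  exact ⟨hpos, hcond.trans hdens, hcond⟩
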